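/- Let $G$ be a nontrivial homogeneous group, i.e. a simply connected nilpotent Lie group with a family of dilations $(\delta_r)_{r>0}$: a smooth one-parameter group of automorphisms of $G$ (with $\delta_r\circ\delta_s=\delta_{rs}$) whose differentials at the identity $e$ are $\exp(A\log r)$, where $A$ is a diagonalizable endomorphism of the Lie algebra with positive eigenvalues. Let $\rho=\operatorname{tr}A$ be its homogeneous dimension, let $|\cdot|$ be a homogeneous norm on $G$ (continuous, $|x|\ge 0$, $|x|=0\iff x=e$, $|x^{-1}|=|x|$, $|\delta_r x|=r|x|$), put $$\gamma=\inf\{c>0:\ |xy|\le c(|x|+|y|)\ \ \forall x,y\in G\},\qquad B(x,r)=\{y\in G:\ |x^{-1}y|<r\},$$ and let $\lambda$ be a left Haar measure on $G$. For every $r>0$ let $\pi_r$ be a uniform partition of $G$ at scale $r$: a partition of $G$ into Borel sets such that, with $U=B\bigl(e,\tfrac{r}{4\gamma^2}\bigr)$, every $P\in\pi_r$ contains a point $x_P$ with $x_PU\subset P\subset x_PU^2$. For a class $f$, modulo $\lambda$-a.e. equality, of $\lambda$-measurable complex functions on $G$ and $q,p,\alpha\in[1,\infty]$ put $$\|f\|_{q,p}^{\pi_r}=\Bigl(\sum_{P\in\pi_r}\|f\chi_P\|_{L^q}^p\Bigr)^{1/p}\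 (p<\infty),\qquad \|f\|_{q,\infty}^{\pi_r}=\sup_{P\in\pi_r}\|f\chi_P\|_{L^q},$$ $$\|f\|_{q,p,\alpha}=\sup_{r>0}\lambda(B(e,r))^{\frac1\alpha-\frac1q}\|f\|_{q,p}^{\pi_r},\qquad \|f\|^*_{\alpha,\infty}=\sup_{t>0}t^{1/\alpha}f^*(t),$$ where $f^*(t)=\inf\{s>0:\ \lambda(\{|f|>s\})\le t\}$, and let $(L^q,L^p)^\alpha(G)$ and $L^{\alpha,\infty}(G)$ be the sets of those $f$ with $\|f\|_{q,p,\alpha}<\infty$ and with $\|f\|^*_{\alpha,\infty}<\infty$, respectively. Let $1\le q<\alpha<p\le\infty$ and, for $n\ge1$, put $J_n=\lfloor 2^{\rho(n+1)}\rfloor+1$. Let $x_j^n\in G$ $(n\ge1,\ 1\le j\le J_n)$ be any points such that (i) for all $n\ge1$ and all $j\ne k$ in $\{1,\dots,J_n\}$, $$\bigl|(x_k^n)^{-1}x_j^n\bigr|>\gamma(1+\gamma+2\gamma^2)\,2^{\frac{(n+1)q}{\alpha-q}};$$ (ii) for all $n>1$, $1\le m\le n$, $1\le k\le J_n$, $1\le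 j\le J_m$ with $m\ne n$ or $j\ne k$, $$\bigl|(x_k^n)^{-1}x_j^m\bigr|>2\gamma^2\Bigl|2^{2^{\rho(n+1)}+1}+2^{k-n}+2^{-n-1}-2^{2^{\rho(m+1)}+1}-2^{j-m}-2^{-m-1}\Bigr|.$$ Let $E=\bigcup_{n\ge1}\bigcup_{j=1}^{J_n}B(x_j^n,2^{-n-1})$ and $f=\chi_E$. Then $f$ is $\lambda$-measurable, $f\in(L^q,L^p)^\alpha(G)$, and $f\notin L^{\alpha,\infty}(G)$. Moreover, for all $1\le q<\alpha<p\le\infty$, the inclusion $L^{\alpha,\infty}(G)\subset(L^q,L^p)^\alpha(G)$ holds and is strict. -/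

import Mathlib

open MeasureTheory Set
open scoped ENNReal NNReal Manifold ContDiff Pointwise

noncomputable section

/-- A family of dilations `(δ_r)_{r > 0}` on a Lie group `G` modelled on `E`: a smooth one-parameter
group of automorphisms of `G` whose differentials at the identity are
`exp (A log r)`, where the endomorphism `A` of the Lie algebra is diagonalizable with positive
eigenvalues. Here `A` is given by an eigenbasis `basis` with eigenvalues `weight i`, so that
`exp (A log r)` multiplies `basis i` by `r ^ weight i`. The values at `r ≤ 0` are irrelevant. -/
structure DilationFamily (E : Type*) [NormedAddCommGroup E] [NormedSpace ℝ E]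
    [FiniteDimensional ℝ E] (G : Type*) [Group G] [TopologicalSpace G] [ChartedSpace E G] where
  δ : ℝ → G →* G
  δ_one : δ 1 = MonoidHom.id G
  δ_mul : ∀ r s : ℝ, 0 < r → 0 < s → δ (r * s) = (δ r).comp (δ s)
  smooth : ContMDiffOn (𝓘(ℝ, ℝ).prod 𝓘(ℝ, E)) 𝓘(ℝ, E) ∞
    (fun z : ℝ × G => δ z.1 z.2) (Ioi 0 ×ˢ univ)
  basis : Module.Basis (Fin (Module.finrank ℝ E)) ℝ (GroupLieAlgebra 𝓘(ℝ, E) G)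
  weight : Fin (Module.finrank ℝ E) → ℝ
  weight_pos : ∀ i, 0 < weight i
  mfderiv_δ : ∀ r : ℝ, 0 < r → ∀ i,
    mfderiv 𝓘(ℝ, E) 𝓘(ℝ, E) (δ r) (1 : G) (basis i) = (r ^ weight i) • basis i

section Homogeneous

variable {E : Type*} [NormedAddCommGroup E] [NormedSpace ℝ E] [FiniteDimensional ℝ E]
  {G : Type*} [Group G] [TopologicalSpace G] [ChartedSpace E G]

/-- The homogeneous dimension, i.e. the trace of `A`. -/
def DilationFamily.homDim (D : DilationFamily E G) : ℝ := ∑ i, D.weight i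

/-- A homogeneous norm on a group with dilations. -/
structure HomogeneousNorm (D : DilationFamily E G) where
  norm : G → ℝ
  continuous_norm : Continuous norm
  norm_nonneg : ∀ x, 0 ≤ norm x
  norm_eq_zero : ∀ x, norm x = 0 ↔ x = 1
  norm_inv : ∀ x, norm x⁻¹ = norm x
  norm_δ : ∀ r : ℝ, 0 < r → ∀ x, norm (D.δ r x) = r * norm x

namespace HomogeneousNorm

variable {D : DilationFamily E G}

/-- The best constant in the quasi-triangle inequality. -/
def gamma (N : HomogeneousNorm D) : ℝ :=
  sInf {c : ℝ | 0 < c ∧ ∀ x y : G, N.norm (x * y) ≤ c * (N.norm x + N.norm y)}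

/-- The ball of centre `x` and radius `r`. -/
def ball (N : HomogeneousNorm D) (x : G) (r : ℝ) : Set G := {y | N.norm (x⁻¹ * y) < r}

end HomogeneousNorm

end Homogeneous

/-- `π` is a `U`-`V` uniform partition of `G` into Borel sets (for neighbourhoods `U`, `V` of the
identity). -/
def IsUniformPartition {G : Type*} [Group G] [MeasurableSpace G] (U V : Set G)
    (π : Set (Set G)) : Prop :=
  Setoid.IsPartition π ∧
    ∀ P ∈ π, MeasurableSet P ∧ ∃ x ∈ P, x • U ⊆ P ∧ P ⊆ x • V

section Norms

variable {G : Type*} [MeasurableSpace G]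

open Classical in
/-- The amalgam norm of `f` for the partition `π`: the `ℓ^p` norm over `P ∈ π` of the `L^q` norms
of `f χ_P`. -/
def amalgamNorm (μ : Measure G) (π : Set (Set G)) (q p : ℝ≥0∞) (f : G → ℂ) : ℝ≥0∞ :=
  if p = ⊤ then ⨆ P ∈ π, eLpNorm (P.indicator f) q μ
  else (∑' P : π, eLpNorm ((P : Set G).indicator f) q μ ^ p.toReal) ^ (1 / p.toReal)

/-- The distribution function of `f`. -/
def distribFun (μ : Measure G) (f : G → ℂ) (s : ℝ≥0) : ℝ≥0∞ := μ {x | s < ‖f x‖₊}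

/-- The decreasing rearrangement of `f` (with value `∞` when the infimum is over the empty set). -/
def rearrangement (μ : Measure G) (f : G → ℂ) (t : ℝ≥0) : ℝ≥0∞ :=
  ⨅ (s : ℝ≥0) (_ : 0 < s ∧ distribFun μ f s ≤ t), (s : ℝ≥0∞)

/-- The Lorentz quasi-norm `‖f‖*_{α,∞} = sup_{t > 0} t^{1/α} f*(t)` (with `1/∞ = 0`). -/
def weakNorm (μ : Measure G) (α : ℝ≥0∞) (f : G → ℂ) : ℝ≥0∞ :=
  ⨆ (t : ℝ≥0) (_ : 0 < t), (t : ℝ≥0∞) ^ (α⁻¹).toReal * rearrangement μ f t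

/-- The Lorentz space `L^{α,∞}(G)`, as a set of classes of functions modulo a.e. equality. -/
def weakSpace (μ : Measure G) (α : ℝ≥0∞) : Set (G →ₘ[μ] ℂ) := {f | weakNorm μ α f < ⊤}

end Norms

section Fofana

variable {E : Type*} [NormedAddCommGroup E] [NormedSpace ℝ E] [FiniteDimensional ℝ E]
  {G : Type*} [Group G] [TopologicalSpace G] [ChartedSpace E G] [MeasurableSpace G]
  {D : DilationFamily E G}

/-- `(π_r)_{r > 0}` is a choice, for every `r > 0`, of a `U`-`U²` uniform partition of `G`
with `U = B(e, r / (4 γ²))`. -/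
def IsPartitionScale (N : HomogeneousNorm D) (π : ℝ → Set (Set G)) : Prop :=
  ∀ r : ℝ, 0 < r →
    IsUniformPartition (N.ball 1 (r / (4 * N.gamma ^ 2)))
      (N.ball 1 (r / (4 * N.gamma ^ 2)) * N.ball 1 (r / (4 * N.gamma ^ 2))) (π r)

/-- `‖f‖_{q,p,α} = sup_{r > 0} λ(B(e,r))^{1/α - 1/q} ‖f‖_{q,p}^{π_r}`. -/
def fofanaNorm (N : HomogeneousNorm D) (μ : Measure G) (π : ℝ → Set (Set G)) (q p α : ℝ≥0∞)
    (f : G → ℂ) : ℝ≥0∞ :=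
  ⨆ (r : ℝ) (_ : 0 < r),
    μ (N.ball 1 r) ^ ((α⁻¹).toReal - (q⁻¹).toReal) * amalgamNorm μ (π r) q p f

/-- The space `(L^q, L^p)^α(G)`, as a set of classes of functions modulo a.e. equality. -/
def fofanaSpace (N : HomogeneousNorm D) (μ : Measure G) (π : ℝ → Set (Set G)) (q p α : ℝ≥0∞) :
    Set (G →ₘ[μ] ℂ) :=
  {f | fofanaNorm N μ π q p α f < ⊤}

/-- The number `⌊2^{ρ(n+1)}⌋ + 1` of balls at level `n`. -/
def levelCard (D : DilationFamily E G) (n : ℕ) : ℕ := ⌊(2 : ℝ) ^ (D.homDim * (n + 1))⌋₊ + 1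

/-- The separation conditions on the centres `x n j = x_j^n`,
`n ≥ 1`, `1 ≤ j ≤ ⌊2^{ρ(n+1)}⌋ + 1`. -/
structure IsSeparatedFamily (N : HomogeneousNorm D) (q α : ℝ≥0∞) (x : ℕ → ℕ → G) : Prop where
  level : ∀ n : ℕ, 1 ≤ n → ∀ k ∈ Finset.Icc 1 (levelCard D n), ∀ j ∈ Finset.Icc 1 (levelCard D n),
    j ≠ k →
    N.norm ((x n k)⁻¹ * x n j) >
      N.gamma * (1 + N.gamma + 2 * N.gamma ^ 2) *
        (2 : ℝ) ^ (((n : ℝ) + 1) * q.toReal / (α.toReal - q.toReal))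
  cross : ∀ n : ℕ, 1 < n → ∀ m ∈ Finset.Icc 1 n,
    ∀ k ∈ Finset.Icc 1 (levelCard D n), ∀ j ∈ Finset.Icc 1 (levelCard D m),
    (m ≠ n ∨ j ≠ k) →
    N.norm ((x n k)⁻¹ * x m j) >
      2 * N.gamma ^ 2 *
        |(2 : ℝ) ^ ((2 : ℝ) ^ (D.homDim * (n + 1)) + 1) + (2 : ℝ) ^ ((k : ℤ) - (n : ℤ))
            + (2 : ℝ) ^ (-(n : ℤ) - 1)
          - (2 : ℝ) ^ ((2 : ℝ) ^ (D.homDim * (m + 1)) + 1) - (2 : ℝ) ^ ((j : ℤ) - (m : ℤ))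
            - (2 : ℝ) ^ (-(m : ℤ) - 1)|

/-- The union of the balls `B(x_j^n, 2^{-n-1})`, `n ≥ 1`, `1 ≤ j ≤ ⌊2^{ρ(n+1)}⌋ + 1`. -/
def ballUnion (N : HomogeneousNorm D) (x : ℕ → ℕ → G) : Set G :=
  ⋃ (n : ℕ) (_ : 1 ≤ n) (j ∈ Finset.Icc 1 (levelCard D n)),
    N.ball (x n j) ((2 : ℝ) ^ (-(n : ℤ) - 1))

end Fofana

end

/-! ### Amalgam norms and weak `L^α` -/

section Amalgam

/-! Both halves rest on one interpolation estimate, `amalgamNorm_indicator_const_le`: if every cell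
meets `F` in measure at most `M`, then the amalgam norm of `χ_F` is at most `M^{1/q-1/p}
λ(F)^{1/p}`. A function is dominated by a countable sum of multiples of indicators, and Minkowski's
inequality (`amalgamNorm_le_tsum`) reduces everything to convergence of geometric series, uniformly
in `r`. Write `V = λ(B(e,r))`; cells have measure at most `V`.

Inclusion: cut `f` at the heights `2^k A V^{-1/α}`, where `A` bounds the weak norm. The superlevel
sets have measure at most `2^{-kα} V`. Taking `M = 2^{-kα} V` for `k ≥ 0` and `M = V` for `k ≤ 0`
gives terms `2A·2^{k(1-α/q)}` and `2A·2^{k(1-α/p)}`. These are free of `V` and summable because `q <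
α < p`.

Counterexample: level `n` of `E` consists of about `2^{ρ(n+1)}` balls of measure comparable to
`2^{-ρ(n+1)}`, so each level has measure bounded above and below. Levels are eventually disjoint,
hence `λ(E) = ∞` and `χ_E` is not in weak `L^α`. For `r` up to `2^{(n+1)q/(α-q)}` a cell meets at
most one ball of level `n`, so `M` is small; for larger `r` the factor `V^{1/α-1/q}` is small.
Either way level `n` contributes a geometric term. Strictness follows because centres with the
required separation exist.

The geometric input is that balls are relatively compact and `λ(B(e,r)) = r^ρ λ(B(e,1))`. Both come
from the differential of `δ_r` at the identity: small dilations contract near `e`, and the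
determinant `r^ρ` governs the volume of small balls in a chart. -/

/-- Minkowski's inequality for countable sums of nonnegative functions. -/
theorem eLpNorm_tsum_le {X ι : Type*} [MeasurableSpace X] [Countable ι] {m : Measure X} {p : ℝ≥0∞}
    (hp : 1 ≤ p) {g : ι → X → ℝ≥0∞} (hg : ∀ i, Measurable (g i)) :
    eLpNorm (fun x => ∑' i, g i x) p m ≤ ∑' i, eLpNorm (g i) p m := by
  by_cases hpt : p = ⊤
  · subst hpt
    simp only [eLpNorm_exponent_top]
    refine eLpNormEssSup_le_of_ae_enorm_bound ?_
    have h : ∀ᵐ x ∂m, ∀ i, ‖g i x‖ₑ ≤ eLpNormEssSup (g i) m :=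
      ae_all_iff.2 fun i => enorm_ae_le_eLpNormEssSup (g i) m
    filter_upwards [h] with x hx
    simp only [enorm_eq_self] at hx ⊢
    exact ENNReal.tsum_le_tsum hx
  · have hp0 : p ≠ 0 := (zero_lt_one.trans_le hp).ne'
    have hr : 0 < p.toReal := ENNReal.toReal_pos hp0 hpt
    rw [eLpNorm_eq_lintegral_rpow_enorm_toReal hp0 hpt, one_div, ENNReal.rpow_inv_le_iff hr]
    -- The series is a directed supremum of finite sums, so monotone convergence reduces the claim
    -- to finite Minkowski.
    have h1 : ∀ x, ‖∑' i, g i x‖ₑ ^ p.toReal = ⨆ s : Finset ι, (∑ i ∈ s, g i x) ^ p.toReal := by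
      intro x
      rw [enorm_eq_self, ENNReal.tsum_eq_iSup_sum]
      exact (ENNReal.orderIsoRpow p.toReal hr).map_iSup _
    simp only [h1]
    rw [lintegral_iSup_directed]
    · refine iSup_le fun s => ?_
      rw [← ENNReal.rpow_inv_le_iff hr, ← one_div]
      have h2 := eLpNorm_sum_le (μ := m) (p := p) (f := g) (s := s)
        (fun i _ => (hg i).aestronglyMeasurable) hp
      rw [eLpNorm_eq_lintegral_rpow_enorm_toReal hp0 hpt] at h2
      simp only [enorm_eq_self, Finset.sum_apply] at h2
      exact h2.trans (ENNReal.sum_le_tsum s)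
    · exact fun s => ((Finset.measurable_sum s fun i _ => hg i).pow_const _).aemeasurable
    · refine Monotone.directed_le fun s t hst x => ?_
      exact ENNReal.rpow_le_rpow (Finset.sum_le_sum_of_subset hst) hr.le

variable {G : Type*} [MeasurableSpace G] {μ : Measure G} {π : Set (Set G)} {q p : ℝ≥0∞}

/-- Makes the amalgam norm an iterated Lebesgue norm, with one formula for finite and infinite `p`.
The σ-algebra `⊤` on the cells removes measurability questions. -/
theorem amalgamNorm_eq_eLpNorm_count (hp : p ≠ 0) (f : G → ℂ) :
    amalgamNorm μ π q p f =
      @eLpNorm π ℝ≥0∞ _ ⊤ (fun P : π => eLpNorm ((P : Set G).indicator f) q μ) p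
        (@Measure.count π ⊤) := by
  let _ : MeasurableSpace π := ⊤
  unfold amalgamNorm
  split_ifs with h
  · subst h
    rw [eLpNorm_exponent_top, eLpNormEssSup_count]
    simp only [enorm_eq_self, iSup_subtype']
  · rw [eLpNorm_eq_lintegral_rpow_enorm_toReal hp h, lintegral_count]
    simp only [enorm_eq_self]

/-- Minkowski applied twice: in `L^q` on each cell, then in `ℓ^p` over the cells. -/
theorem amalgamNorm_le_tsum {ι : Type*} [Countable ι] (hq : 1 ≤ q) (hp : 1 ≤ p)
    (hπ : ∀ P ∈ π, MeasurableSet P) {f : G → ℂ} {g : ι → G → ℂ} (hg : ∀ i, Measurable (g i))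
    (hfg : ∀ x, ‖f x‖ₑ ≤ ∑' i, ‖g i x‖ₑ) :
    amalgamNorm μ π q p f ≤ ∑' i, amalgamNorm μ π q p (g i) := by
  have hp0 : p ≠ 0 := (zero_lt_one.trans_le hp).ne'
  simp only [amalgamNorm_eq_eLpNorm_count hp0]
  let _ : MeasurableSpace π := ⊤
  refine le_trans ?_ (eLpNorm_tsum_le hp fun i => measurable_from_top)
  refine eLpNorm_mono_enorm fun P => ?_
  simp only [enorm_eq_self]
  calc eLpNorm ((P : Set G).indicator f) q μ
      ≤ eLpNorm (fun x => ∑' i, ‖(P : Set G).indicator (g i) x‖ₑ) q μ := by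
        refine eLpNorm_mono_enorm fun x => ?_
        by_cases hx : x ∈ (P : Set G)
        · simpa [hx] using hfg x
        · simp [hx]
    _ ≤ ∑' i, eLpNorm (fun x => ‖(P : Set G).indicator (g i) x‖ₑ) q μ :=
        eLpNorm_tsum_le hq fun i => ((hg i).indicator (hπ P P.2)).enorm
    _ = ∑' i, eLpNorm ((P : Set G).indicator (g i)) q μ := by simp only [eLpNorm_enorm]

theorem amalgamNorm_congr_ae {f g : G → ℂ} (h : f =ᵐ[μ] g) :
    amalgamNorm μ π q p f = amalgamNorm μ π q p g := by
  have h1 : ∀ P : Set G, eLpNorm (P.indicator f) q μ = eLpNorm (P.indicator g) q μ := fun P =>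
    eLpNorm_congr_ae (h.indicator)
  simp only [amalgamNorm, h1]

theorem weakNorm_congr_ae {α : ℝ≥0∞} {f g : G → ℂ} (h : f =ᵐ[μ] g) :
    weakNorm μ α f = weakNorm μ α g := by
  have h1 : ∀ s, distribFun μ f s = distribFun μ g s := fun s => by
    refine measure_congr ?_
    filter_upwards [h] with x hx
    change (s < ‖f x‖₊) = (s < ‖g x‖₊)
    rw [hx]
  simp only [weakNorm, rearrangement, h1]

theorem tsum_measure_inter_le (hpart : Setoid.IsPartition π) (hπ : ∀ P ∈ π, MeasurableSet P)
    {F : Set G} (hF : MeasurableSet F) : ∑' P : π, μ ((P : Set G) ∩ F) ≤ μ F := by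
  refine (tsum_meas_le_meas_iUnion_of_disjoint μ (fun P : π => (hπ P P.2).inter hF) ?_).trans
    (measure_mono (iUnion_subset fun P => inter_subset_right))
  intro P Q hPQ
  exact (hpart.pairwiseDisjoint P.2 Q.2 (fun h => hPQ (Subtype.ext h))).mono inter_subset_left
    inter_subset_left

/-- Interpolation between the supremum and the sum over cells: `∑ μ(P ∩ F)^{p/q} ≤ M^{p/q-1} ∑ μ(P ∩
F)`, and the cells are disjoint. -/
theorem amalgamNorm_indicator_const_le (hq : 1 ≤ q) (hqp : q < p)
    (hpart : Setoid.IsPartition π) (hπ : ∀ P ∈ π, MeasurableSet P) {F : Set G}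
    (hF : MeasurableSet F) (c : ℂ) {M : ℝ≥0∞} (hM : ∀ P ∈ π, μ (P ∩ F) ≤ M) :
    amalgamNorm μ π q p (F.indicator fun _ => c) ≤
      ‖c‖ₑ * (M ^ ((q⁻¹).toReal - (p⁻¹).toReal) * μ F ^ (p⁻¹).toReal) := by
  have hq0 : q ≠ 0 := (zero_lt_one.trans_le hq).ne'
  have hqt : q ≠ ⊤ := hqp.ne_top
  have hqr : 0 < q.toReal := ENNReal.toReal_pos hq0 hqt
  have key : ∀ P ∈ π, eLpNorm (P.indicator (F.indicator fun _ => c)) q μ =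
      ‖c‖ₑ * μ (P ∩ F) ^ (q⁻¹).toReal := by
    intro P hP
    rw [indicator_indicator, eLpNorm_indicator_const ((hπ P hP).inter hF) hq0 hqt,
      ENNReal.toReal_inv, one_div]
  unfold amalgamNorm
  split_ifs with h
  · refine iSup₂_le fun P hP => ?_
    rw [key P hP, h]
    simp only [ENNReal.inv_top, ENNReal.toReal_zero, sub_zero, ENNReal.rpow_zero, mul_one]
    gcongr
    exact hM P hP
  · have hp0 : p ≠ 0 := (zero_lt_one.trans_le (hq.trans hqp.le)).ne'
    have hpr : 0 < p.toReal := ENNReal.toReal_pos hp0 h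
    have hlt : q.toReal < p.toReal := (ENNReal.toReal_lt_toReal hqt h).2 hqp
    rw [one_div, ENNReal.rpow_inv_le_iff hpr]
    have hθ : 0 ≤ (q.toReal⁻¹ - p.toReal⁻¹) * p.toReal := by
      have := inv_anti₀ hqr hlt.le
      exact mul_nonneg (by linarith) hpr.le
    have hb : ∀ P : π, eLpNorm ((P : Set G).indicator (F.indicator fun _ => c)) q μ ^ p.toReal ≤
        ‖c‖ₑ ^ p.toReal * M ^ ((q.toReal⁻¹ - p.toReal⁻¹) * p.toReal) * μ ((P : Set G) ∩ F) := by
      intro P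
      rw [key P P.2, ENNReal.mul_rpow_of_nonneg _ _ hpr.le, mul_assoc, ENNReal.toReal_inv]
      gcongr
      rw [← ENNReal.rpow_mul]
      have he : q.toReal⁻¹ * p.toReal = (q.toReal⁻¹ - p.toReal⁻¹) * p.toReal + 1 := by
        field_simp
        ring
      rw [he, ENNReal.rpow_add_of_nonneg _ _ hθ zero_le_one, ENNReal.rpow_one]
      gcongr
      exact hM P P.2
    refine (ENNReal.tsum_le_tsum hb).trans ?_
    rw [ENNReal.tsum_mul_left, ENNReal.mul_rpow_of_nonneg _ _ hpr.le,
      ENNReal.mul_rpow_of_nonneg _ _ hpr.le, ← ENNReal.rpow_mul, ← ENNReal.rpow_mul,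
      ENNReal.toReal_inv, ENNReal.toReal_inv, inv_mul_cancel₀ hpr.ne', ENNReal.rpow_one, mul_assoc]
    gcongr
    exact tsum_measure_inter_le hpart hπ hF

/-- The weak-type estimate for the distribution function. -/
theorem distribFun_le_of_weakNorm_le {α : ℝ≥0∞} (hα0 : α ≠ 0) (hαt : α ≠ ⊤) {f : G → ℂ} {A : ℝ≥0∞}
    (hA : weakNorm μ α f ≤ A) {s : ℝ≥0} (hs : 0 < s) :
    distribFun μ f s ≤ (A / s) ^ α.toReal := by
  have hr : 0 < α.toReal := ENNReal.toReal_pos hα0 hαt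
  refine ENNReal.le_of_forall_nnreal_lt fun t ht => ?_
  rcases eq_or_ne t 0 with rfl | ht0
  · simp
  have h1 : (s : ℝ≥0∞) ≤ rearrangement μ f t := by
    refine le_iInf₂ fun u hu => ?_
    rw [ENNReal.coe_le_coe]
    by_contra! hus
    have : distribFun μ f s ≤ distribFun μ f u :=
      measure_mono fun x hx => lt_trans hus hx
    exact absurd (this.trans hu.2) (not_le.2 ht)
  have h2 : (t : ℝ≥0∞) ^ (α⁻¹).toReal * s ≤ A :=
    le_trans (by gcongr) ((le_iSup₂ (f := fun (t : ℝ≥0) (_ : 0 < t) =>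
      (t : ℝ≥0∞) ^ (α⁻¹).toReal * rearrangement μ f t) t (pos_iff_ne_zero.2 ht0)).trans hA)
  have hs' : (s : ℝ≥0∞) ≠ 0 := by simpa using hs.ne'
  rw [← ENNReal.rpow_inv_le_iff hr, ← ENNReal.toReal_inv]
  exact (ENNReal.le_div_iff_mul_le (Or.inl hs') (Or.inl ENNReal.coe_ne_top)).2 h2

theorem summable_two_rpow_neg_mul_abs {η : ℝ} (hη : 0 < η) :
    Summable fun k : ℤ => (2 : ℝ) ^ (-(η * |(k : ℝ)|)) := by
  have h : Summable fun n : ℕ => (2 : ℝ) ^ (-(η * |((n : ℤ) : ℝ)|)) := by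
    have : ∀ n : ℕ, (2 : ℝ) ^ (-(η * |((n : ℤ) : ℝ)|)) = ((2 : ℝ) ^ (-η)) ^ n := fun n => by
      rw [← Real.rpow_natCast, ← Real.rpow_mul (by norm_num)]
      simp
    simp only [this]
    exact summable_geometric_of_lt_one (by positivity)
      (Real.rpow_lt_one_of_one_lt_of_neg (by norm_num) (by linarith))
  refine Summable.of_nat_of_neg h ?_
  simpa using h

/-- A function in weak `L^α` satisfies the amalgam estimate at the scale `V` of the partition,
with a constant that does not depend on `V`. -/
theorem exists_rpow_mul_amalgamNorm_le {α : ℝ≥0∞} (hq : 1 ≤ q) (hqα : q < α) (hαp : α < p)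
    {f : G → ℂ} (hf : Measurable f) (hfα : weakNorm μ α f < ⊤) :
    ∃ C : ℝ≥0∞, C ≠ ⊤ ∧ ∀ (π : Set (Set G)) (V : ℝ≥0), 0 < V → Setoid.IsPartition π →
      (∀ P ∈ π, MeasurableSet P) → (∀ P ∈ π, μ P ≤ V) →
      (V : ℝ≥0∞) ^ ((α⁻¹).toReal - (q⁻¹).toReal) * amalgamNorm μ π q p f ≤ C := by
  have hq0 : q ≠ 0 := (zero_lt_one.trans_le hq).ne'
  have hqt : q ≠ ⊤ := hqα.ne_top
  have hα0 : α ≠ 0 := (zero_lt_one.trans_le (hq.trans hqα.le)).ne'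
  have hαt : α ≠ ⊤ := hαp.ne_top
  set a : ℝ := (α⁻¹).toReal with ha
  set b : ℝ := (q⁻¹).toReal with hb
  set e : ℝ := (p⁻¹).toReal with he
  have he0 : 0 ≤ e := ENNReal.toReal_nonneg
  have hea : e < a := (ENNReal.toReal_lt_toReal (ENNReal.inv_ne_top.2 (hα0.bot_lt.trans hαp).ne')
    (ENNReal.inv_ne_top.2 hα0)).2 (ENNReal.inv_lt_inv.2 hαp)
  have hab : a < b := (ENNReal.toReal_lt_toReal (ENNReal.inv_ne_top.2 hα0)
    (ENNReal.inv_ne_top.2 hq0)).2 (ENNReal.inv_lt_inv.2 hqα)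
  have ha0 : 0 < a := he0.trans_lt hea
  have hαa : α.toReal = a⁻¹ := by rw [ha, ENNReal.toReal_inv, inv_inv]
  -- Adding 1 keeps the cutting heights positive even when the weak norm vanishes.
  set A : ℝ≥0 := (weakNorm μ α f).toNNReal + 1 with hA
  have hAw : weakNorm μ α f ≤ A := by
    rw [hA, ENNReal.coe_add, ENNReal.coe_toNNReal hfα.ne]
    exact le_self_add
  have hA0 : 0 < A := by positivity
  -- The slower of the two decay rates, as `k → ∞` and as `k → -∞`.
  set η : ℝ := min (b / a - 1) (1 - e / a) with hη
  have hη0 : 0 < η := by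
    refine lt_min ?_ ?_
    · rw [sub_pos, lt_div_iff₀ ha0]; linarith
    · rw [sub_pos, div_lt_iff₀ ha0]; linarith
  refine ⟨∑' k : ℤ, ENNReal.ofReal (2 * A * (2 : ℝ) ^ (-(η * |(k : ℝ)|))),
    ((summable_two_rpow_neg_mul_abs hη0).mul_left _).tsum_ofReal_ne_top, ?_⟩
  intro π V hV hpart hπ hPV
  -- The normalisation `V^{-a}` makes the bound on `μ (F k)` proportional to `V`, so all powers of
  -- `V` cancel at the end.
  set s : ℤ → ℝ≥0 := fun k => 2 ^ k * (A * V ^ (-a)) with hs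
  have hs0 : ∀ k, 0 < s k := fun k => by positivity
  set F : ℤ → Set G := fun k => {x | s k < ‖f x‖₊} with hF
  have hFm : ∀ k, MeasurableSet (F k) := fun k =>
    measurableSet_lt measurable_const hf.nnnorm
  have hle := amalgamNorm_le_tsum (μ := μ) (π := π) (f := f)
    (g := fun k => (F k).indicator fun _ => ((2 * s k : ℝ) : ℂ)) hq
    ((hq.trans hqα.le).trans hαp.le) hπ
    (fun k => measurable_const.indicator (hFm k)) (fun x => by
      by_cases hx : f x = 0
      · simp [hx]
      have hpos : 0 < ‖f x‖ / (A * V ^ (-a) : ℝ≥0) := by positivity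
      obtain ⟨k, hk1, hk2⟩ := exists_mem_Ioc_zpow hpos (one_lt_two (α := ℝ))
      refine le_trans ?_ (ENNReal.le_tsum k)
      have hc : (0 : ℝ) < (A * V ^ (-a) : ℝ≥0) := by positivity
      rw [lt_div_iff₀ hc] at hk1
      rw [div_le_iff₀ hc] at hk2
      have hmem : x ∈ F k := by
        change s k < ‖f x‖₊
        rw [← NNReal.coe_lt_coe]
        simpa [hs] using hk1
      rw [indicator_of_mem hmem, enorm_le_iff_norm_le]
      rw [Complex.norm_real, Real.norm_of_nonneg (by positivity)]
      refine hk2.trans (le_of_eq ?_)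
      rw [zpow_add_one₀ two_ne_zero]
      simp only [hs]
      push_cast
      ring)
  refine (mul_le_mul_right hle _).trans ?_
  rw [← ENNReal.tsum_mul_left]
  refine ENNReal.tsum_le_tsum fun k => ?_
  -- the measure of the superlevel set
  have hμF : μ (F k) ≤ ((2 : ℝ≥0) ^ (-(k / a) : ℝ) * V : ℝ≥0) := by
    refine (distribFun_le_of_weakNorm_le hα0 hαt hAw (hs0 k)).trans (le_of_eq ?_)
    rw [hαa, ← ENNReal.coe_div (hs0 k).ne', ← ENNReal.coe_rpow_of_nonneg _ (by positivity)]
    congr 1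
    have : A / s k = 2 ^ (-(k : ℝ)) * V ^ a := by
      simp only [hs]
      rw [NNReal.rpow_neg, NNReal.rpow_neg, NNReal.rpow_intCast]
      field_simp
    rw [this, NNReal.mul_rpow, ← NNReal.rpow_mul, ← NNReal.rpow_mul, mul_inv_cancel₀ ha0.ne',
      NNReal.rpow_one]
    congr 2
    ring
  have hb2 : ∀ M : ℝ≥0, 0 < M → (∀ P ∈ π, μ (P ∩ F k) ≤ M) →
      (V : ℝ≥0∞) ^ (a - b) *
        amalgamNorm μ π q p ((F k).indicator fun _ => ((2 * s k : ℝ) : ℂ)) ≤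
      ENNReal.ofReal ((V : ℝ) ^ (a - b) * ((2 * s k) *
        ((M : ℝ) ^ (b - e) * ((2 : ℝ) ^ (-(k / a) : ℝ) * V) ^ e))) := by
    intro M hM0 hM
    have h := amalgamNorm_indicator_const_le (μ := μ) (p := p) hq (hqα.trans hαp) hpart hπ (hFm k)
      ((2 * s k : ℝ) : ℂ) hM
    refine (mul_le_mul_right (h.trans (mul_le_mul_right (mul_le_mul_right
      (ENNReal.rpow_le_rpow hμF he0) _) _)) _).trans (le_of_eq ?_)
    rw [ENNReal.ofReal_mul (p := (V : ℝ) ^ (a - b)) (by positivity),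
      ENNReal.ofReal_mul (p := 2 * (s k : ℝ)) (by positivity),
      ENNReal.ofReal_mul (p := (M : ℝ) ^ (b - e)) (by positivity), ← ENNReal.ofReal_rpow_of_pos (by positivity),
      ← ENNReal.ofReal_rpow_of_pos (by positivity), ← ENNReal.ofReal_rpow_of_pos (by positivity)]
    congr 2
    · simp
    · rw [← ofReal_norm, Complex.norm_real, Real.norm_of_nonneg (by positivity)]
    · congr 2
      · simp
      · rw [ENNReal.coe_nnreal_eq]
        simp
  -- Once every factor is an exponential, the power identities below are identities between
  -- exponents.
  have hlogs : (s k : ℝ) = Real.exp (Real.log 2 * k + Real.log A - a * Real.log V) := by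
    simp only [hs]
    push_cast
    rw [← Real.rpow_intCast, Real.rpow_def_of_pos two_pos,
      Real.rpow_def_of_pos (by exact_mod_cast hV), sub_eq_add_neg, Real.exp_add, Real.exp_add,
      Real.exp_log (by exact_mod_cast hA0), mul_assoc]
    congr 3
    ring
  have hV' : (0 : ℝ) < V := by exact_mod_cast hV
  have hA' : (0 : ℝ) < A := by exact_mod_cast hA0
  have hl2 : 0 < Real.log 2 := Real.log_pos one_lt_two
  have hlogV : (V : ℝ) = Real.exp (Real.log V) := (Real.exp_log hV').symm
  have hlogA : (A : ℝ) = Real.exp (Real.log A) := (Real.exp_log hA').symm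
  have h2 : ∀ y : ℝ, (2 : ℝ) ^ y = Real.exp (Real.log 2 * y) := fun y =>
    Real.rpow_def_of_pos two_pos y
  have fin : ∀ y : ℝ, y ≤ -(η * |(k : ℝ)|) → ENNReal.ofReal (2 * A * (2 : ℝ) ^ y) ≤
      ENNReal.ofReal (2 * A * (2 : ℝ) ^ (-(η * |(k : ℝ)|))) := fun y hy =>
    ENNReal.ofReal_le_ofReal (mul_le_mul_of_nonneg_left
      (Real.rpow_le_rpow_of_exponent_le one_le_two hy) (by positivity))
  -- High levels are controlled by the measure of the superlevel set, low levels by the measure of a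
  -- cell.
  rcases le_total 0 k with hk | hk
  · have hk' : (0 : ℝ) ≤ k := by exact_mod_cast hk
    refine (hb2 (2 ^ (-(k / a) : ℝ) * V) (by positivity)
      (fun P _ => (measure_mono inter_subset_right).trans hμF)).trans
      (le_trans (le_of_eq ?_) (fin (-((b / a - 1) * k)) ?_))
    · congr 1
      push_cast
      rw [hlogs, h2, h2, hlogV, hlogA]
      simp only [← Real.exp_add, ← Real.exp_mul, Real.log_exp, mul_assoc]
      rw [mul_left_comm]
      simp only [← Real.exp_add]
      congr 2
      field_simp
      ring
    · rw [abs_of_nonneg hk']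
      have := min_le_left (b / a - 1) (1 - e / a)
      nlinarith
  · have hk' : (k : ℝ) ≤ 0 := by exact_mod_cast hk
    refine (hb2 V hV (fun P hP => (measure_mono inter_subset_left).trans (hPV P hP))).trans
      (le_trans (le_of_eq ?_) (fin ((1 - e / a) * k) ?_))
    · congr 1
      rw [hlogs, h2, h2, hlogV, hlogA]
      simp only [← Real.exp_add, ← Real.exp_mul, Real.log_exp, mul_assoc]
      rw [mul_left_comm]
      simp only [← Real.exp_add]
      congr 2
      field_simp
      ring
    · rw [abs_of_nonpos hk']
      have := min_le_right (b / a - 1) (1 - e / a)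
      nlinarith

end Amalgam

/-! ### Linearisation of the dilations at the identity -/

section LocalStructure

open Filter Topology

variable {E : Type*} [NormedAddCommGroup E] [NormedSpace ℝ E] [FiniteDimensional ℝ E]
  {G : Type*} [Group G] [TopologicalSpace G] [ChartedSpace E G]

namespace DilationFamily

variable (D : DilationFamily E G)

/-- The eigenbasis, as a basis of the model space. -/
def modelBasis : Module.Basis (Fin (Module.finrank ℝ E)) ℝ E := D.basis

theorem contMDiff_δ {r : ℝ} (hr : 0 < r) : ContMDiff 𝓘(ℝ, E) 𝓘(ℝ, E) ∞ (D.δ r) := by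
  intro x
  have h := D.smooth.contMDiffAt (x := (r, x)) ((Ioi_mem_nhds hr |> fun h => prod_mem_nhds h univ_mem))
  exact h.comp x (contMDiffAt_const.prodMk contMDiffAt_id)

theorem continuous_δ {r : ℝ} (hr : 0 < r) : Continuous (D.δ r) := (D.contMDiff_δ hr).continuous

theorem continuousOn_δ_apply (x : G) : ContinuousOn (fun r => D.δ r x) (Ioi 0) := by
  refine D.smooth.continuousOn.comp (f := fun r : ℝ => (r, x)) (by fun_prop) ?_
  intro r hr
  exact ⟨hr, mem_univ _⟩

/-- The dilation read in the preferred chart at the identity. -/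
def chartδ (r : ℝ) (u : E) : E := chartAt E (1 : G) (D.δ r ((chartAt E (1 : G)).symm u))

theorem contDiffAt_chartδ {r : ℝ} (hr : 0 < r) :
    ContDiffAt ℝ ∞ (D.chartδ r) (chartAt E (1 : G) 1) := by
  have h := (contMDiffAt_iff.1 (D.contMDiff_δ hr 1)).2
  simp only [map_one, modelWithCornersSelf_coe, range_id, contDiffWithinAt_univ] at h
  exact h

theorem fderiv_chartδ {r : ℝ} (hr : 0 < r) (i : Fin (Module.finrank ℝ E)) :
    fderiv ℝ (D.chartδ r) (chartAt E (1 : G) 1) (D.modelBasis i) =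
      (r ^ D.weight i) • D.modelBasis i := by
  have h := D.mfderiv_δ r hr i
  have hm : MDifferentiableAt 𝓘(ℝ, E) 𝓘(ℝ, E) (D.δ r) (1 : G) :=
    (D.contMDiff_δ hr 1).mdifferentiableAt (by simp)
  have hw : writtenInExtChartAt 𝓘(ℝ, E) 𝓘(ℝ, E) (1 : G) (D.δ r) = D.chartδ r := by
    unfold writtenInExtChartAt
    rw [map_one]
    rfl
  have e : fderivWithin ℝ (writtenInExtChartAt 𝓘(ℝ, E) 𝓘(ℝ, E) (1 : G) (D.δ r))
      (range 𝓘(ℝ, E)) (extChartAt 𝓘(ℝ, E) (1 : G) 1) =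
        fderiv ℝ (D.chartδ r) (chartAt E (1 : G) 1) := by
    rw [hw]
    simp only [modelWithCornersSelf_coe, range_id, fderivWithin_univ]
    rfl
  have e2 : @Eq (E →L[ℝ] E) (mfderiv 𝓘(ℝ, E) 𝓘(ℝ, E) (D.δ r) (1 : G))
      (fderiv ℝ (D.chartδ r) (chartAt E (1 : G) 1)) :=
    Eq.trans (hm.mfderiv : @Eq (E →L[ℝ] E) _ _) e
  exact (DFunLike.congr_fun e2 (D.modelBasis i)).symm.trans h

theorem hasStrictFDerivAt_chartδ {r : ℝ} (hr : 0 < r) :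
    HasStrictFDerivAt (D.chartδ r) (fderiv ℝ (D.chartδ r) (chartAt E (1 : G) 1))
      (chartAt E (1 : G) 1) :=
  (D.contDiffAt_chartδ hr).hasStrictFDerivAt (by simp)

theorem det_fderiv_chartδ {r : ℝ} (hr : 0 < r) :
    (fderiv ℝ (D.chartδ r) (chartAt E (1 : G) 1)).det = r ^ D.homDim := by
  rw [ContinuousLinearMap.det, ← LinearMap.det_toMatrix D.modelBasis]
  have : LinearMap.toMatrix D.modelBasis D.modelBasis
      (fderiv ℝ (D.chartδ r) (chartAt E (1 : G) 1) : E →ₗ[ℝ] E) =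
      Matrix.diagonal fun i => r ^ D.weight i := by
    ext i j
    rw [LinearMap.toMatrix_apply, ContinuousLinearMap.coe_coe, D.fderiv_chartδ hr]
    by_cases hij : i = j
    · subst hij; simp
    · simp [Matrix.diagonal_apply_ne _ hij, Ne.symm hij]
  rw [this, Matrix.det_diagonal, homDim, Real.rpow_sum_of_pos hr]

/-- All weights are positive, so every eigenvalue `t ^ weight i` tends to 0 with `t`. -/
theorem exists_norm_fderiv_chartδ_lt {ε : ℝ} (hε : 0 < ε) :
    ∃ t ∈ Ioo (0 : ℝ) 1, ‖fderiv ℝ (D.chartδ t) (chartAt E (1 : G) 1)‖ < ε := by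
  obtain ⟨C, hC, hCb⟩ := D.modelBasis.exists_opNorm_le (F := E)
  have hlim : Tendsto (fun t : ℝ => C * ∑ i, t ^ D.weight i * ‖D.modelBasis i‖) (𝓝[>] 0) (𝓝 0) := by
    have : Tendsto (fun t : ℝ => C * ∑ i, t ^ D.weight i * ‖D.modelBasis i‖) (𝓝[>] 0)
        (𝓝 (C * ∑ i : Fin (Module.finrank ℝ E), 0 * ‖D.modelBasis i‖)) := by
      refine (tendsto_finsetSum _ fun i _ => ?_).const_mul C
      refine Tendsto.mul_const _ ?_
      have := (Real.continuousAt_rpow_const 0 (D.weight i) (Or.inr (D.weight_pos i).le)).tendsto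
      rw [Real.zero_rpow (D.weight_pos i).ne'] at this
      exact this.mono_left nhdsWithin_le_nhds
    simpa using this
  have hev := (hlim.eventually (gt_mem_nhds hε)).and (Ioo_mem_nhdsGT (zero_lt_one (α := ℝ)))
  obtain ⟨t, ht, ht1⟩ := hev.exists
  refine ⟨t, ht1, (hCb (Finset.sum_nonneg fun i _ => ?_) fun i => ?_).trans_lt ht⟩
  · have := ht1.1
    positivity
  · rw [D.fderiv_chartδ ht1.1, norm_smul, Real.norm_of_nonneg (Real.rpow_nonneg ht1.1.le _)]
    exact Finset.single_le_sum (f := fun i => t ^ D.weight i * ‖D.modelBasis i‖)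
      (fun j _ => mul_nonneg (Real.rpow_nonneg ht1.1.le _) (norm_nonneg _)) (Finset.mem_univ i)

end DilationFamily

end LocalStructure

/-! ### Topology and measure of homogeneous balls -/

section HomogeneousBalls

open Filter Topology

variable {E : Type*} [NormedAddCommGroup E] [NormedSpace ℝ E] [FiniteDimensional ℝ E]
  {G : Type*} [Group G] [TopologicalSpace G] [ChartedSpace E G]

namespace DilationFamily

variable (D : DilationFamily E G)

theorem δ_δ {r s : ℝ} (hr : 0 < r) (hs : 0 < s) (x : G) : D.δ r (D.δ s x) = D.δ (r * s) x := by
  rw [D.δ_mul r s hr hs]; rfl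

theorem δ_inv_δ {r : ℝ} (hr : 0 < r) (x : G) : D.δ r⁻¹ (D.δ r x) = x := by
  rw [D.δ_δ (inv_pos.2 hr) hr, inv_mul_cancel₀ hr.ne', D.δ_one]; rfl

theorem δ_δ_inv {r : ℝ} (hr : 0 < r) (x : G) : D.δ r (D.δ r⁻¹ x) = x := by
  rw [D.δ_δ hr (inv_pos.2 hr), mul_inv_cancel₀ hr.ne', D.δ_one]; rfl

/-- A dilation as an automorphism of the topological group. -/
noncomputable def δEquiv {r : ℝ} (hr : 0 < r) : G ≃ₜ* G where
  toFun := D.δ r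
  invFun := D.δ r⁻¹
  left_inv := D.δ_inv_δ hr
  right_inv := D.δ_δ_inv hr
  map_mul' := map_mul _
  continuous_toFun := D.continuous_δ hr
  continuous_invFun := D.continuous_δ (inv_pos.2 hr)

/-- In the chart, `δ_t` for small `t` contracts towards the identity by the factor 1/2: 1/4 from the
differential and 1/4 from the remainder. -/
theorem exists_nhds_tendsto_δ_pow :
    ∃ t ∈ Ioo (0 : ℝ) 1, ∀ᶠ y in 𝓝 (1 : G), Tendsto (fun n : ℕ => D.δ (t ^ n) y) atTop (𝓝 1) := by
  obtain ⟨t, ht, htn⟩ := D.exists_norm_fderiv_chartδ_lt (ε := 1 / 4) (by norm_num)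
  refine ⟨t, ht, ?_⟩
  set φ := chartAt E (1 : G) with hφ
  have h1s : (1 : G) ∈ φ.source := mem_chart_source E 1
  have hT0 : D.chartδ t (φ 1) = φ 1 := by
    rw [chartδ, ← hφ, φ.left_inv h1s, map_one]
  have hd := (D.hasStrictFDerivAt_chartδ ht.1).hasFDerivAt.isLittleO.def
    (c := 1 / 4) (by norm_num)
  have hcon : ∀ᶠ u in 𝓝 (φ 1), ‖D.chartδ t u - φ 1‖ ≤ 1 / 2 * ‖u - φ 1‖ := by
    filter_upwards [hd] with u hu
    rw [hT0] at hu
    have h2 := ContinuousLinearMap.le_opNorm (fderiv ℝ (D.chartδ t) (φ 1)) (u - φ 1)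
    have h3 := norm_sub_norm_le (D.chartδ t u - φ 1) (fderiv ℝ (D.chartδ t) (φ 1) (u - φ 1))
    have h4 : ‖fderiv ℝ (D.chartδ t) (φ 1)‖ * ‖u - φ 1‖ ≤ 1 / 4 * ‖u - φ 1‖ :=
      mul_le_mul_of_nonneg_right htn.le (norm_nonneg _)
    linarith
  have hsrc : ∀ᶠ y in 𝓝 (1 : G), D.δ t y ∈ φ.source := by
    refine (D.continuous_δ ht.1).continuousAt.eventually ?_
    rw [map_one]
    exact φ.open_source.mem_nhds h1s
  have hsrc' : ∀ᶠ u in 𝓝 (φ 1), D.δ t (φ.symm u) ∈ φ.source := by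
    have : Tendsto φ.symm (𝓝 (φ 1)) (𝓝 1) := by
      have := (φ.continuousAt_symm (φ.map_source h1s)).tendsto
      rwa [φ.left_inv h1s] at this
    exact this.eventually hsrc
  obtain ⟨s, hs, hball⟩ := Metric.nhds_basis_ball.eventually_iff.1 (hcon.and hsrc')
  have hW : ∀ᶠ y in 𝓝 (1 : G), y ∈ φ.source ∧ φ y ∈ Metric.ball (φ 1) s :=
    Filter.Eventually.and (φ.open_source.mem_nhds h1s)
      ((φ.continuousAt h1s).eventually (Metric.ball_mem_nhds _ hs))
  filter_upwards [hW] with y hy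
  have hn : ∀ n : ℕ, D.δ (t ^ n) y ∈ φ.source ∧
      ‖φ (D.δ (t ^ n) y) - φ 1‖ ≤ (1 / 2) ^ n * ‖φ y - φ 1‖ := by
    intro n
    induction n with
    | zero => simp [D.δ_one, hy.1]
    | succ n ih =>
      have hmem : φ (D.δ (t ^ n) y) ∈ Metric.ball (φ 1) s := by
        rw [mem_ball_iff_norm]
        refine ih.2.trans_lt (lt_of_le_of_lt ?_ (mem_ball_iff_norm.1 hy.2))
        exact mul_le_of_le_one_left (norm_nonneg _) (pow_le_one₀ (by norm_num) (by norm_num))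
      have h5 := hball hmem
      rw [φ.left_inv ih.1] at h5
      have h6 : D.δ (t ^ (n + 1)) y = D.δ t (D.δ (t ^ n) y) := by
        rw [D.δ_δ ht.1 (pow_pos ht.1 n), pow_succ']
      rw [h6]
      refine ⟨h5.2, ?_⟩
      have h7 := h5.1
      rw [chartδ, ← hφ, φ.left_inv ih.1] at h7
      refine h7.trans ?_
      rw [pow_succ']
      linarith [ih.2]
  have hlim : Tendsto (fun n : ℕ => φ (D.δ (t ^ n) y)) atTop (𝓝 (φ 1)) := by
    rw [tendsto_iff_norm_sub_tendsto_zero]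
    refine squeeze_zero (fun n => norm_nonneg _) (fun n => (hn n).2) ?_
    simpa using (tendsto_pow_atTop_nhds_zero_of_lt_one (r := (1 / 2 : ℝ)) (by norm_num)
      (by norm_num)).mul_const ‖φ y - φ 1‖
  have := ((φ.continuousAt_symm (φ.map_source h1s)).tendsto.comp hlim)
  rw [φ.left_inv h1s] at this
  refine this.congr fun n => ?_
  simp [φ.left_inv (hn n).1]

/-- The points attracted to the identity form a subgroup, which is open by the local result and
hence everything by connectedness. -/
theorem exists_tendsto_δ_pow [IsTopologicalGroup G] [ConnectedSpace G] :
    ∃ t ∈ Ioo (0 : ℝ) 1, ∀ y : G, Tendsto (fun n : ℕ => D.δ (t ^ n) y) atTop (𝓝 1) := by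
  obtain ⟨t, ht, hev⟩ := D.exists_nhds_tendsto_δ_pow
  refine ⟨t, ht, ?_⟩
  let H : Subgroup G :=
    { carrier := {y | Tendsto (fun n : ℕ => D.δ (t ^ n) y) atTop (𝓝 1)}
      mul_mem' := fun {x y} hx hy => by
        simpa using Tendsto.mul hx hy
      one_mem' := by simpa using tendsto_const_nhds
      inv_mem' := fun {x} hx => by
        simpa using Tendsto.inv hx }
  have hopen : IsOpen (H : Set G) := H.isOpen_of_mem_nhds (g := 1) hev
  have huniv : (H : Set G) = univ :=
    IsClopen.eq_univ ⟨H.isClosed_of_isOpen hopen, hopen⟩ ⟨1, H.one_mem⟩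
  intro y
  have : y ∈ (H : Set G) := huniv ▸ mem_univ y
  exact this

end DilationFamily

namespace HomogeneousNorm

variable {D : DilationFamily E G} (N : HomogeneousNorm D)

theorem isOpen_ball [ContinuousMul G] (x : G) (r : ℝ) : IsOpen (N.ball x r) :=
  isOpen_lt (N.continuous_norm.comp (continuous_const.mul continuous_id)) continuous_const

theorem norm_one : N.norm 1 = 0 := (N.norm_eq_zero 1).2 rfl

theorem mem_ball_one {y : G} {r : ℝ} : y ∈ N.ball 1 r ↔ N.norm y < r := by
  simp [ball]

theorem norm_pos {x : G} (hx : x ≠ 1) : 0 < N.norm x :=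
  (N.norm_nonneg x).lt_of_ne fun h => hx ((N.norm_eq_zero x).1 h.symm)

theorem image_δ_ball {r : ℝ} (hr : 0 < r) (s : ℝ) : D.δ r '' N.ball 1 s = N.ball 1 (r * s) := by
  ext y
  simp only [mem_image, mem_ball_one]
  constructor
  · rintro ⟨x, hx, rfl⟩
    rw [N.norm_δ r hr]
    gcongr
  · intro hy
    refine ⟨D.δ r⁻¹ y, ?_, D.δ_δ_inv hr y⟩
    rw [N.norm_δ _ (inv_pos.2 hr), inv_mul_lt_iff₀ hr]
    exact hy

section Topology

variable [IsTopologicalGroup G]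

theorem t2Space (N : HomogeneousNorm D) : T2Space G := by
  have : IsClosed ({1} : Set G) := by
    have h : ({1} : Set G) = N.norm ⁻¹' {0} := by
      ext x
      simp [N.norm_eq_zero]
    rw [h]
    exact isClosed_singleton.preimage N.continuous_norm
  have := IsTopologicalGroup.t1Space G this
  infer_instance

variable [ConnectedSpace G]

/-- Let `m` be the minimum of the norm on the frontier of a compact neighbourhood `K`. If `|y| < m`
and `y ∉ K`, the orbit `δ_r y` with `r ≤ 1` ends inside `K`, so it crosses the frontier at a point
of norm `r|y| < m`, a contradiction. -/
theorem exists_ball_subset {W : Set G} (hW : W ∈ 𝓝 (1 : G)) : ∃ m > 0, N.ball 1 m ⊆ W := by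
  have := N.t2Space
  have := ChartedSpace.locallyCompactSpace E G
  obtain ⟨t, ht, htend⟩ := D.exists_tendsto_δ_pow
  obtain ⟨K, hK, hKW, hKc⟩ := local_compact_nhds hW
  have hfc : IsCompact (frontier K) := hKc.of_isClosed_subset isClosed_frontier
    hKc.isClosed.frontier_subset
  have h1 : (1 : G) ∈ interior K := mem_interior_iff_mem_nhds.2 hK
  obtain ⟨m, hm0, hm⟩ : ∃ m > 0, ∀ z ∈ frontier K, m ≤ N.norm z := by
    rcases (frontier K).eq_empty_or_nonempty with he | hne
    · exact ⟨1, one_pos, by simp [he]⟩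
    · obtain ⟨z, hz, hzm⟩ := hfc.exists_isMinOn hne N.continuous_norm.continuousOn
      refine ⟨N.norm z, N.norm_pos ?_, fun w hw => hzm hw⟩
      rintro rfl
      exact hz.2 h1
  refine ⟨m, hm0, fun y hy => hKW ?_⟩
  rw [mem_ball_one] at hy
  by_contra hyK
  obtain ⟨n, hn⟩ := ((htend y).eventually (interior_mem_nhds.2 hK)).exists
  have htn : 0 < t ^ n := pow_pos ht.1 n
  have htn1 : t ^ n ≤ 1 := pow_le_one₀ ht.1.le ht.2.le
  have hpre : IsPreconnected ((fun r => D.δ r y) '' Icc (t ^ n) 1) :=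
    isPreconnected_Icc.image _ ((D.continuousOn_δ_apply y).mono fun r hr => htn.trans_le hr.1)
  obtain ⟨z, ⟨r, hr, rfl⟩, hz⟩ :
      (((fun r => D.δ r y) '' Icc (t ^ n) 1) ∩ frontier K).Nonempty := by
    by_contra hemp
    rw [not_nonempty_iff_eq_empty] at hemp
    obtain ⟨w, -, hw1, hw2⟩ := hpre (interior K) Kᶜ isOpen_interior hKc.isClosed.isOpen_compl
      (fun z hz => by
        by_cases hzK : z ∈ K
        · by_contra h3
          have : z ∈ frontier K := ⟨subset_closure hzK, fun h4 => h3 (Or.inl h4)⟩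
          exact (hemp ▸ ⟨hz, this⟩ : z ∈ (∅ : Set G))
        · exact Or.inr hzK)
      ⟨_, ⟨t ^ n, ⟨le_rfl, htn1⟩, rfl⟩, hn⟩
      ⟨_, ⟨1, ⟨htn1, le_rfl⟩, rfl⟩, by simpa [D.δ_one] using hyK⟩
    exact hw2 (interior_subset hw1)
  have h2 := hm _ hz
  simp only [N.norm_δ r (htn.trans_le hr.1)] at h2
  have := mul_le_of_le_one_left (N.norm_nonneg y) hr.2
  linarith

/-- True for one small ball, and dilations carry it to all radii. -/
theorem exists_isCompact_ball_subset (r : ℝ) : ∃ K, IsCompact K ∧ N.ball 1 r ⊆ K := by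
  have := ChartedSpace.locallyCompactSpace E G
  obtain ⟨K, hKc, hK⟩ := exists_compact_mem_nhds (1 : G)
  obtain ⟨m, hm, hmK⟩ := N.exists_ball_subset hK
  rcases le_or_gt r 0 with hr | hr
  · refine ⟨∅, isCompact_empty, fun y hy => ?_⟩
    rw [mem_ball_one] at hy
    exact absurd hy (not_lt.2 (hr.trans (N.norm_nonneg y)))
  · refine ⟨D.δ (r / m) '' K, hKc.image (D.continuous_δ (by positivity)), ?_⟩
    have h := N.image_δ_ball (r := r / m) (by positivity) m
    rw [div_mul_cancel₀ _ hm.ne'] at h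
    rw [← h]
    exact image_mono hmK

theorem secondCountableTopology (N : HomogeneousNorm D) : SecondCountableTopology G := by
  choose K hK hKb using fun n : ℕ => N.exists_isCompact_ball_subset (n : ℝ)
  have : SigmaCompactSpace G := ⟨⟨K, hK, eq_univ_of_forall fun x => by
    obtain ⟨n, hn⟩ := exists_nat_gt (N.norm x)
    exact mem_iUnion.2 ⟨n, hKb n (N.mem_ball_one.2 hn)⟩⟩⟩
  exact ChartedSpace.secondCountable_of_sigmaCompact E G

/-- By homogeneity one may assume `|x| + |y| = 1`; then `xy` stays in a fixed compact set. This
makes the set defining `gamma` nonempty. -/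
theorem exists_norm_mul_le : ∃ c > 0, ∀ x y : G, N.norm (x * y) ≤ c * (N.norm x + N.norm y) := by
  obtain ⟨K, hKc, hK⟩ := N.exists_isCompact_ball_subset 2
  obtain ⟨C, hC⟩ := (hKc.mul hKc).bddAbove_image N.continuous_norm.continuousOn
  refine ⟨max C 1, by positivity, fun x y => ?_⟩
  set s := N.norm x + N.norm y with hs
  have hx := N.norm_nonneg x
  have hy := N.norm_nonneg y
  rcases (add_nonneg hx hy).eq_or_lt with h0 | h0
  · have hx0 : x = 1 := (N.norm_eq_zero x).1 (by linarith)
    have hy0 : y = 1 := (N.norm_eq_zero y).1 (by linarith)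
    rw [← hs] at h0
    simp [hx0, hy0, N.norm_one, ← h0]
  · rw [← hs] at h0
    have hin : ∀ z, N.norm z ≤ s → D.δ s⁻¹ z ∈ K := fun z hz => hK <| by
      rw [mem_ball_one, N.norm_δ _ (inv_pos.2 h0), inv_mul_lt_iff₀ h0]
      linarith
    have h3 := hC ⟨_, mul_mem_mul (hin x (by linarith)) (hin y (by linarith)), rfl⟩
    rw [← map_mul, N.norm_δ _ (inv_pos.2 h0), inv_mul_le_iff₀ h0] at h3
    rw [mul_comm]
    exact h3.trans (mul_le_mul_of_nonneg_left (le_max_left _ _) h0.le)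

theorem norm_mul_le (x y : G) : N.norm (x * y) ≤ N.gamma * (N.norm x + N.norm y) := by
  obtain ⟨c, hc, hcb⟩ := N.exists_norm_mul_le
  have hx := N.norm_nonneg x
  have hy := N.norm_nonneg y
  rcases (add_nonneg hx hy).eq_or_lt with h0 | h0
  · have := hcb x y
    rw [← h0] at this ⊢
    simpa using this
  · rw [← div_le_iff₀ h0]
    exact le_csInf ⟨c, hc, hcb⟩ fun d hd => (div_le_iff₀ h0).2 (hd.2 x y)

theorem one_le_gamma [Nontrivial G] : 1 ≤ N.gamma := by
  obtain ⟨c, hc, hcb⟩ := N.exists_norm_mul_le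
  obtain ⟨x, hx⟩ := exists_ne (1 : G)
  refine le_csInf ⟨c, hc, hcb⟩ fun d hd => ?_
  have h := hd.2 x 1
  rw [mul_one, N.norm_one, add_zero] at h
  exact (le_mul_iff_one_le_left (N.norm_pos hx)).1 h

end Topology

section Measure

variable [IsTopologicalGroup G] [MeasurableSpace G] (μ : Measure G) [μ.IsHaarMeasure]

theorem measure_ball_pos (x : G) {r : ℝ} (hr : 0 < r) : 0 < μ (N.ball x r) :=
  (N.isOpen_ball x r).measure_pos μ ⟨x, by simpa [ball, N.norm_one] using hr⟩

variable [BorelSpace G]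

theorem measurableSet_ball (x : G) (r : ℝ) : MeasurableSet (N.ball x r) :=
  (N.isOpen_ball x r).measurableSet

theorem measure_ball (x : G) (r : ℝ) : μ (N.ball x r) = μ (N.ball 1 r) := by
  have : N.ball x r = (fun y => x⁻¹ * y) ⁻¹' N.ball 1 r := by
    ext y
    simp [ball]
  rw [this, measure_preimage_mul]

theorem measure_ball_lt_top [ConnectedSpace G] (x : G) (r : ℝ) : μ (N.ball x r) < ⊤ := by
  obtain ⟨K, hK, hKb⟩ := N.exists_isCompact_ball_subset r
  rw [N.measure_ball μ]
  exact (measure_mono hKb).trans_lt hK.measure_lt_top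

end Measure

end HomogeneousNorm

end HomogeneousBalls

/-! ### Haar measure scales by the homogeneous dimension -/

section HaarScaling

open Filter Topology

variable {E : Type*} [NormedAddCommGroup E] [NormedSpace ℝ E]
  {G : Type*} [Group G] [TopologicalSpace G] [ChartedSpace E G]

section Comparison

/-- The group law read in the preferred chart at the identity. -/
def chartMul (E : Type*) [NormedAddCommGroup E] [NormedSpace ℝ E] (G : Type*) [Group G]
    [TopologicalSpace G] [ChartedSpace E G] (z : E × E) : E :=
  chartAt E (1 : G) ((chartAt E (1 : G)).symm z.1 * (chartAt E (1 : G)).symm z.2)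

theorem contDiffAt_chartMul [LieGroup 𝓘(ℝ, E) ∞ G] :
    ContDiffAt ℝ ∞ (chartMul E G) (chartAt E (1 : G) 1, chartAt E (1 : G) 1) := by
  set φ := chartAt E (1 : G) with hφ
  have h1s : (1 : G) ∈ φ.source := mem_chart_source E 1
  rw [← contMDiffAt_iff_contDiffAt]
  have hs : ContMDiffAt 𝓘(ℝ, E) 𝓘(ℝ, E) ∞ φ.symm (φ 1) :=
    contMDiffOn_chart_symm.contMDiffAt (φ.open_target.mem_nhds (φ.map_source h1s))
  have h1 : ContMDiffAt 𝓘(ℝ, E × E) 𝓘(ℝ, E) ∞ (fun z : E × E => φ.symm z.1) (φ 1, φ 1) :=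
    ContMDiffAt.comp (φ 1, φ 1) (g := φ.symm) (f := Prod.fst) hs contDiff_fst.contMDiff.contMDiffAt
  have h2 : ContMDiffAt 𝓘(ℝ, E × E) 𝓘(ℝ, E) ∞ (fun z : E × E => φ.symm z.2) (φ 1, φ 1) :=
    ContMDiffAt.comp (φ 1, φ 1) (g := φ.symm) (f := Prod.snd) hs contDiff_snd.contMDiff.contMDiffAt
  have h3 := h1.mul h2
  have h4 : ContMDiffAt 𝓘(ℝ, E) 𝓘(ℝ, E) ∞ φ
      ((fun z : E × E => φ.symm z.1 * φ.symm z.2) (φ 1, φ 1)) := by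
    simp only [φ.left_inv h1s, mul_one]
    exact contMDiffOn_chart.contMDiffAt (φ.open_source.mem_nhds h1s)
  exact ContMDiffAt.comp (φ 1, φ 1) h4 h3

variable [FiniteDimensional ℝ E] [LieGroup 𝓘(ℝ, E) ∞ G] [MeasurableSpace E] [BorelSpace E]
  (ν : Measure E) [ν.IsAddHaarMeasure]

/-- Right translations by elements close to the identity distort the volume in the chart at the
identity by a factor of at most two. -/
theorem exists_nhds_chart_translation :
    ∃ W ∈ 𝓝 (1 : G), ∃ Y ∈ 𝓝 (1 : G), ∀ y ∈ Y, ∀ A ⊆ W,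
      (· * y) '' A ⊆ (chartAt E (1 : G)).source ∧
      ν (chartAt E (1 : G) '' ((· * y) '' A)) ≤ 2 * ν (chartAt E (1 : G) '' A) ∧
      ν (chartAt E (1 : G) '' A) ≤ 2 * ν (chartAt E (1 : G) '' ((· * y) '' A)) := by
  have := topologicalGroup_of_lieGroup (G := G) 𝓘(ℝ, E) ∞
  set φ := chartAt E (1 : G) with hφ
  have h1s : (1 : G) ∈ φ.source := mem_chart_source E 1
  set F' := fderiv ℝ (chartMul E G) (φ 1, φ 1) with hF'
  have hF : HasStrictFDerivAt (chartMul E G) F' (φ 1, φ 1) :=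
    contDiffAt_chartMul.hasStrictFDerivAt (by simp)
  -- Right translation by the identity is the identity map; strict differentiability extends this
  -- approximately to nearby `y`.
  have hid : F'.comp (ContinuousLinearMap.inl ℝ E E) = ContinuousLinearMap.id ℝ E := by
    have h1 : HasFDerivAt (fun u : E => chartMul E G (u, φ 1))
        (F'.comp (ContinuousLinearMap.inl ℝ E E)) (φ 1) :=
      HasFDerivAt.comp (g := chartMul E G) (f := fun u : E => (u, φ 1)) (φ 1) hF.hasFDerivAt
        (hasFDerivAt_prodMk_left (φ 1) (φ 1))
    have h2 : HasFDerivAt (fun u : E => chartMul E G (u, φ 1))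
        (ContinuousLinearMap.id ℝ E) (φ 1) := by
      refine (hasFDerivAt_id (φ 1)).congr_of_eventuallyEq ?_
      filter_upwards [φ.open_target.mem_nhds (φ.map_source h1s)] with u hu
      simp only [chartMul, ← hφ, φ.left_inv h1s, mul_one, φ.right_inv hu, id]
    exact h1.unique h2
  have hdet : (ContinuousLinearMap.id ℝ E).det = 1 := by
    simp [ContinuousLinearMap.det]
  have hu := addHaar_image_le_mul_of_det_lt ν (ContinuousLinearMap.id ℝ E) (m := 2)
    (by rw [hdet]; simp)
  have hl := mul_le_addHaar_image_of_lt_det ν (ContinuousLinearMap.id ℝ E) (m := 1 / 2)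
    (by rw [hdet]; simp)
  obtain ⟨c, ⟨hcu, hcl⟩, hc⟩ := ((hu.and hl).and self_mem_nhdsWithin).exists
  obtain ⟨s, hs, hsF⟩ := hF.approximates_deriv_on_nhds (c := c) (Or.inr hc)
  have hφc := φ.continuousAt h1s
  have hev : ∀ᶠ z : G × G in 𝓝 ((1 : G), (1 : G)),
      ((φ z.1, φ z.2) ∈ s ∧ z.1 ∈ φ.source ∧ z.2 ∈ φ.source) ∧ z.1 * z.2 ∈ φ.source := by
    refine (Filter.Eventually.and ?_ (Filter.Eventually.and ?_ ?_)).and ?_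
    · have : ContinuousAt (fun z : G × G => (φ z.1, φ z.2)) ((1 : G), (1 : G)) :=
        (ContinuousAt.comp (x := ((1 : G), (1 : G))) (g := φ) hφc continuousAt_fst).prodMk
          (ContinuousAt.comp (x := ((1 : G), (1 : G))) (g := φ) hφc continuousAt_snd)
      exact this hs
    · exact continuousAt_fst.eventually (φ.open_source.mem_nhds h1s)
    · exact continuousAt_snd.eventually (φ.open_source.mem_nhds h1s)
    · have : ContinuousAt (fun z : G × G => z.1 * z.2) ((1 : G), (1 : G)) :=
        continuous_mul.continuousAt
      refine this.eventually (φ.open_source.mem_nhds ?_)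
      simpa using h1s
  obtain ⟨W, hW, Y, hY, hWY⟩ := mem_nhds_prod_iff.1 hev
  refine ⟨W, hW, Y, hY, fun y hy A hA => ?_⟩
  have hz : ∀ x ∈ A, ((φ x, φ y) ∈ s ∧ x ∈ φ.source ∧ y ∈ φ.source) ∧ x * y ∈ φ.source :=
    fun x hx => hWY (mk_mem_prod (hA hx) hy)
  have himg : φ '' ((· * y) '' A) = (fun u => chartMul E G (u, φ y)) '' (φ '' A) := by
    rw [image_image, image_image]
    refine image_congr fun x hx => ?_
    simp only [chartMul, ← hφ, φ.left_inv (hz x hx).1.2.1, φ.left_inv (hz x hx).1.2.2]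
  have happ : ApproximatesLinearOn (fun u => chartMul E G (u, φ y)) (ContinuousLinearMap.id ℝ E)
      (φ '' A) c := by
    rintro _ ⟨x, hx, rfl⟩ _ ⟨x', hx', rfl⟩
    have h := hsF _ (hz x hx).1.1 _ (hz x' hx').1.1
    have h0 : ((φ x, φ y) - (φ x', φ y) : E × E) = ContinuousLinearMap.inl ℝ E E (φ x - φ x') := by
      simp
    rw [h0, ← ContinuousLinearMap.comp_apply, hid] at h
    simpa using h
  refine ⟨?_, ?_, ?_⟩
  · rintro _ ⟨x, hx, rfl⟩
    exact (hz x hx).2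
  · rw [himg]
    exact hcu _ _ happ
  · rw [himg]
    have := mul_le_mul_right (hcl _ _ happ) 2
    rwa [← mul_assoc, ENNReal.coe_div two_ne_zero, ENNReal.coe_one, ENNReal.coe_ofNat, one_div,
      ENNReal.mul_inv_cancel two_ne_zero ENNReal.ofNat_ne_top, one_mul] at this

/-- In the chart at the identity, a Haar measure is comparable to an additive Haar measure of the
model space. -/
theorem exists_nhds_haar_comparison [T2Space G] [SecondCountableTopology G] [MeasurableSpace G]
    [BorelSpace G] (μ : Measure G) [μ.IsHaarMeasure] :
    ∃ W ∈ 𝓝 (1 : G), ∃ a b c : ℝ≥0∞, a ≠ 0 ∧ b ≠ ⊤ ∧ c ≠ 0 ∧ c ≠ ⊤ ∧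
      ∀ A ⊆ W, MeasurableSet A → a * ν (chartAt E (1 : G) '' A) ≤ c * μ A ∧
        c * μ A ≤ b * ν (chartAt E (1 : G) '' A) := by
  have := topologicalGroup_of_lieGroup (G := G) 𝓘(ℝ, E) ∞
  have := ChartedSpace.locallyCompactSpace E G
  obtain ⟨W, hW, Y, hY, hWY⟩ := exists_nhds_chart_translation (G := G) ν
  set φ := chartAt E (1 : G) with hφ
  have h1s : (1 : G) ∈ φ.source := mem_chart_source E 1
  have hWs : W ⊆ φ.source := by
    have := (hWY 1 (mem_of_mem_nhds hY) W subset_rfl).1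
    simpa using this
  have hφsymm : AEMeasurable φ.symm (ν.restrict φ.target) :=
    φ.continuousOn_symm.aemeasurable φ.open_target.measurableSet
  -- Chart volume transported to the group.
  set ℓ : Measure G := (ν.restrict φ.target).map φ.symm with hℓ
  have hℓA : ∀ A ⊆ φ.source, MeasurableSet A → ℓ A = ν (φ '' A) := by
    intro A hA hAm
    rw [hℓ, Measure.map_apply_of_aemeasurable hφsymm hAm,
      Measure.restrict_apply₀ (hφsymm.nullMeasurableSet_preimage hAm), inter_comm,
      φ.image_eq_target_inter_inv_preimage hA]
  obtain ⟨K, hKc, hK⟩ := exists_compact_mem_nhds (1 : G)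
  -- Ensures that if `z` and `z * y⁻¹` are both near the identity, then `y ∈ K` and `y⁻¹ ∈ Y`.
  have hev : ∀ᶠ z : G × G in 𝓝 ((1 : G), (1 : G)),
      z.1⁻¹ * z.2 ∈ K ∧ (z.1⁻¹ * z.2)⁻¹ ∈ Y := by
    have h1 : Tendsto (fun z : G × G => z.1⁻¹ * z.2) (𝓝 ((1 : G), (1 : G))) (𝓝 1) := by
      have : Continuous fun z : G × G => z.1⁻¹ * z.2 := by fun_prop
      simpa using this.tendsto ((1 : G), (1 : G))
    have h2 : Tendsto (fun z : G × G => (z.1⁻¹ * z.2)⁻¹) (𝓝 ((1 : G), (1 : G))) (𝓝 1) := by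
      simpa using h1.inv
    exact (h1.eventually hK).and (h2.eventually hY)
  rw [nhds_prod_eq] at hev
  obtain ⟨Z, hZ, hZZ⟩ := mem_prod_same_iff.1 hev
  have hbdd : ∀ᶠ x in 𝓝 (1 : G), φ x ∈ Metric.ball (φ 1) 1 :=
    (φ.continuousAt h1s).eventually (Metric.ball_mem_nhds _ one_pos)
  obtain ⟨W₀, hW₀, hW₀o, h1W₀⟩ := mem_nhds_iff.1 (inter_mem (inter_mem hW hZ) hbdd)
  have hW₀s : W₀ ⊆ φ.source := fun x hx => hWs (hW₀ hx).1.1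
  have hmul : ∀ᶠ z : G × G in 𝓝 ((1 : G), (1 : G)), z.1 * z.2 ∈ W₀ := by
    refine (continuous_mul.tendsto ((1 : G), (1 : G))).eventually (hW₀o.mem_nhds ?_)
    simpa using h1W₀
  obtain ⟨W₁, hW₁, Y₁, hY₁, hWY₁⟩ := mem_nhds_prod_iff.1 hmul
  obtain ⟨Y₂, hY₂, hY₂o, h1Y₂⟩ := mem_nhds_iff.1 (inter_mem hY₁ hY)
  have hW₁0 : W₁ ⊆ W₀ := fun x hx => by
    have : (x, (1 : G)) ∈ W₁ ×ˢ Y₁ := ⟨hx, (hY₂ h1Y₂).1⟩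
    simpa using hWY₁ this
  have hℓ0 : ℓ W₀ ≠ 0 := by
    rw [hℓA W₀ hW₀s hW₀o.measurableSet]
    exact ((φ.isOpen_image_of_subset_source hW₀o hW₀s).measure_pos ν
      ⟨φ 1, mem_image_of_mem _ h1W₀⟩).ne'
  have hℓt : ℓ W₀ ≠ ⊤ := by
    rw [hℓA W₀ hW₀s hW₀o.measurableSet]
    refine ((measure_mono ?_).trans_lt (measure_ball_lt_top (μ := ν) (x := φ 1) (r := 1))).ne
    rintro _ ⟨x, hx, rfl⟩
    exact (hW₀ hx).2
  have hYm : MeasurableSet Y₂⁻¹ := hY₂o.inv.measurableSet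
  have hKm : MeasurableSet K := hKc.isClosed.measurableSet
  have hμY : μ Y₂⁻¹ ≠ 0 := (hY₂o.inv.measure_pos μ ⟨1, by simpa using h1Y₂⟩).ne'
  have hmt : ∀ (A : Set G) (y : G), (fun x => (x, y)) ⁻¹' {z : G × G | z.1 * z.2 ∈ A} =
      (· * y⁻¹) '' A := by
    intro A y
    rw [image_mul_right]
    simp
    rfl
  refine ⟨W₁, hW₁, 2⁻¹ * μ Y₂⁻¹, 2 * μ K, ℓ W₀, mul_ne_zero (by simp) hμY,
    ENNReal.mul_ne_top (by simp) hKc.measure_lt_top.ne, hℓ0, hℓt, fun A hA hAm => ?_⟩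
  have hAW : A ⊆ W := fun x hx => (hW₀ (hW₁0 (hA hx))).1.1
  have hSm : MeasurableSet {z : G × G | z.1 * z.2 ∈ A} := measurable_mul hAm
  -- Fubini on `{(x, y) | xy ∈ A}`. One order uses left invariance of `μ`; the other integrates the
  -- chart volumes of right translates of `A`, which are within a factor 2 of that of `A`.
  have hS1 : ((ℓ.restrict W₀).prod μ) {z : G × G | z.1 * z.2 ∈ A} = ℓ W₀ * μ A := by
    rw [Measure.prod_apply hSm]
    have : ∀ x : G, μ (Prod.mk x ⁻¹' {z : G × G | z.1 * z.2 ∈ A}) = μ A := fun x =>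
      measure_preimage_mul μ x A
    simp only [this, lintegral_const, Measure.restrict_apply_univ]
    rw [mul_comm]
  have hAym : ∀ y : G, MeasurableSet ((· * y) '' A) := fun y =>
    (MeasurableEquiv.mulRight y).measurableSet_image.2 hAm
  have hS2 : ℓ W₀ * μ A = ∫⁻ y, ℓ ((· * y⁻¹) '' A ∩ W₀) ∂μ := by
    rw [← hS1, Measure.prod_apply_symm hSm]
    simp only [hmt, Measure.restrict_apply (hAym _)]
  rw [hS2]
  constructor
  · calc 2⁻¹ * μ Y₂⁻¹ * ν (φ '' A) = ∫⁻ _ in Y₂⁻¹, 2⁻¹ * ν (φ '' A) ∂μ := by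
          rw [setLIntegral_const]; ring
      _ ≤ ∫⁻ y in Y₂⁻¹, ℓ ((· * y⁻¹) '' A ∩ W₀) ∂μ := by
          refine setLIntegral_mono' hYm fun y hy => ?_
          have hy' : y⁻¹ ∈ Y₂ := hy
          have hsub : (· * y⁻¹) '' A ⊆ W₀ := by
            rintro _ ⟨x, hx, rfl⟩
            exact hWY₁ (mk_mem_prod (hA hx) (hY₂ hy').1)
          have h := hWY y⁻¹ (hY₂ hy').2 A hAW
          rw [inter_eq_left.2 hsub, hℓA _ h.1 (hAym _), ENNReal.inv_mul_le_iff (by simp) (by simp)]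
          exact h.2.2
      _ ≤ ∫⁻ y, ℓ ((· * y⁻¹) '' A ∩ W₀) ∂μ := setLIntegral_le_lintegral _ _
  · calc ∫⁻ y, ℓ ((· * y⁻¹) '' A ∩ W₀) ∂μ ≤ ∫⁻ y, K.indicator (fun _ => 2 * ν (φ '' A)) y ∂μ := by
          refine lintegral_mono fun y => ?_
          rcases ((· * y⁻¹) '' A ∩ W₀).eq_empty_or_nonempty with he | ⟨_, ⟨z, hz, rfl⟩, hx⟩
          · rw [he, measure_empty]
            exact zero_le
          · have h3 := hZZ (mk_mem_prod (hW₀ hx).1.2 (hW₀ (hW₁0 (hA hz))).1.2)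
            have h4 : (z * y⁻¹)⁻¹ * z = y := by group
            simp only [mem_ofPred_eq, h4] at h3
            have h := hWY y⁻¹ h3.2 A hAW
            rw [indicator_of_mem h3.1]
            refine (measure_mono inter_subset_left).trans ?_
            rw [hℓA _ h.1 (hAym _)]
            exact h.2.1
      _ = 2 * μ K * ν (φ '' A) := by
          rw [lintegral_indicator_const hKm]; ring

end Comparison

/-- If the model space were zero, the group would be discrete and connected, hence trivial. -/
theorem DilationFamily.homDim_pos [FiniteDimensional ℝ E] [IsTopologicalGroup G] [ConnectedSpace G]
    [Nontrivial G] (D : DilationFamily E G) : 0 < D.homDim := by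
  rcases subsingleton_or_nontrivial E with hE | hE
  · have hs : (chartAt E (1 : G)).source = {1} := by
      ext x
      refine ⟨fun hx => ?_, fun hx => by rw [mem_singleton_iff.1 hx]; exact mem_chart_source E 1⟩
      exact (chartAt E (1 : G)).injOn hx (mem_chart_source E 1) (Subsingleton.elim _ _)
    have : DiscreteTopology G :=
      discreteTopology_of_isOpen_singleton_one (hs ▸ (chartAt E (1 : G)).open_source)
    have : Subsingleton G := PreconnectedSpace.trivial_of_discrete
    exact absurd this (not_subsingleton G)
  · have : NeZero (Module.finrank ℝ E) := ⟨Module.finrank_pos.ne'⟩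
    exact Finset.sum_pos (fun i _ => D.weight_pos i) Finset.univ_nonempty

/-- Lets a comparison of measures up to constants identify an exact scaling factor. -/
theorem ENNReal.le_of_forall_mul_pow_le {x y κ m : ℝ≥0∞} (hx : x ≠ 0) (hy : y ≠ ⊤) (hκ : κ ≠ ⊤)
    (h : ∀ n : ℕ, x * κ ^ n ≤ y * m ^ n) : κ ≤ m := by
  by_contra! hlt
  have hκ0 : κ ≠ 0 := (pos_of_gt hlt).ne'
  have hlim : Tendsto (fun n : ℕ => y * (m / κ) ^ n) atTop (𝓝 0) := by
    have h1 : m / κ < 1 := by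
      rw [ENNReal.div_lt_iff (Or.inl hκ0) (Or.inl hκ)]
      simpa using hlt
    simpa using ENNReal.Tendsto.const_mul (ENNReal.tendsto_pow_atTop_nhds_zero_of_lt_one h1)
      (Or.inr hy)
  refine hx (le_zero_iff.1 (ge_of_tendsto' hlim fun n => ?_))
  have h2 : (m / κ) ^ n = m ^ n / κ ^ n := by
    rw [div_eq_mul_inv, div_eq_mul_inv, mul_pow, ENNReal.inv_pow]
  rw [h2, ← mul_div_assoc, ENNReal.le_div_iff_mul_le (Or.inl (pow_ne_zero n hκ0))
    (Or.inl (ENNReal.pow_ne_top hκ))]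
  exact h n

namespace HomogeneousNorm

variable [FiniteDimensional ℝ E] {D : DilationFamily E G} (N : HomogeneousNorm D)

/-- Dilations multiply a Haar measure by a constant. -/
theorem _root_.DilationFamily.exists_measure_image_δ [IsTopologicalGroup G]
    [LocallyCompactSpace G] [MeasurableSpace G] [BorelSpace G] (D : DilationFamily E G) (μ : Measure G)
    [μ.IsHaarMeasure] {r : ℝ} (hr : 0 < r) : ∃ κ : ℝ≥0, ∀ A : Set G, IsOpen A →
      μ (D.δ r '' A) = κ * μ A := by
  have : (μ.map (D.δEquiv hr).symm).IsHaarMeasure := inferInstance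
  refine ⟨Measure.haarScalarFactor (μ.map (D.δEquiv hr).symm) μ, fun A hA => ?_⟩
  have h := Measure.measure_isHaarMeasure_eq_smul_of_isOpen (μ.map (D.δEquiv hr).symm) μ hA
  have h2 : μ.map (D.δEquiv hr).symm A = μ (D.δ r '' A) := by
    have hm : Measurable (D.δEquiv hr).symm := (D.continuous_δ (inv_pos.2 hr)).measurable
    rw [Measure.map_apply hm hA.measurableSet]
    congr 1
    exact ((D.δEquiv hr).toEquiv.image_eq_preimage_symm A).symm
  rw [← h2, h]
  rfl

/-- Dilations by `r < 1` scale the Haar measure of balls by `r ^ homDim`. -/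
theorem measure_ball_mul_of_lt_one [LieGroup 𝓘(ℝ, E) ∞ G] [ConnectedSpace G] [MeasurableSpace G]
    [BorelSpace G] (μ : Measure G) [μ.IsHaarMeasure] {r : ℝ} (hr : r ∈ Ioo (0 : ℝ) 1) (s : ℝ) :
    μ (N.ball 1 (r * s)) = ENNReal.ofReal (r ^ D.homDim) * μ (N.ball 1 s) := by
  have := topologicalGroup_of_lieGroup (G := G) 𝓘(ℝ, E) ∞
  have := ChartedSpace.locallyCompactSpace E G
  have := N.t2Space
  have := N.secondCountableTopology
  borelize E
  let ν : Measure E := Measure.addHaar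
  obtain ⟨κ, hκ⟩ := D.exists_measure_image_δ μ hr.1
  rw [← N.image_δ_ball hr.1, hκ _ (N.isOpen_ball 1 s)]
  congr 1
  obtain ⟨W, hW, a, b, c, ha, hb, hc0, hct, hcomp⟩ := exists_nhds_haar_comparison (G := G) ν μ
  set φ := chartAt E (1 : G) with hφ
  have h1s : (1 : G) ∈ φ.source := mem_chart_source E 1
  set L := fderiv ℝ (D.chartδ r) (φ 1) with hL
  have hstrict := D.hasStrictFDerivAt_chartδ hr.1
  have hdet : ENNReal.ofReal |L.det| = ENNReal.ofReal (r ^ D.homDim) := by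
    rw [hL, D.det_fderiv_chartδ hr.1, abs_of_nonneg (Real.rpow_nonneg hr.1.le _)]
  -- On a small ball `δ_r` is nearly linear at every stage of the iteration, so each step multiplies
  -- chart volume by nearly `|det L| = r^ρ` and Haar measure by exactly `κ`.
  have hstep : ∀ δ : ℝ≥0, 0 < δ → ∃ η > 0, N.ball 1 η ⊆ W ∧ ∀ n : ℕ,
      φ '' N.ball 1 (r ^ (n + 1) * η) = D.chartδ r '' (φ '' N.ball 1 (r ^ n * η)) ∧
      ApproximatesLinearOn (D.chartδ r) L (φ '' N.ball 1 (r ^ n * η)) δ := by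
    intro δ hδ
    obtain ⟨S, hS, hSa⟩ := hstrict.approximates_deriv_on_nhds (c := δ) (Or.inr hδ)
    obtain ⟨η, hη, hηb⟩ := N.exists_ball_subset (inter_mem (inter_mem hW
      (φ.open_source.mem_nhds h1s)) ((φ.continuousAt h1s) hS))
    have hsub : ∀ n : ℕ, N.ball 1 (r ^ n * η) ⊆ N.ball 1 η := fun n x hx => by
      rw [mem_ball_one] at hx ⊢
      exact hx.trans_le (mul_le_of_le_one_left hη.le (pow_le_one₀ hr.1.le hr.2.le))
    refine ⟨η, hη, fun x hx => (hηb hx).1.1, fun n => ⟨?_, ?_⟩⟩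
    · rw [pow_succ', mul_assoc, ← N.image_δ_ball hr.1, image_image, image_image]
      refine image_congr fun x hx => ?_
      rw [DilationFamily.chartδ, ← hφ, φ.left_inv (hηb (hsub n hx)).1.2]
    · refine hSa.mono_set ?_
      rintro _ ⟨x, hx, rfl⟩
      exact (hηb (hsub n hx)).2
  have hball : ∀ (η : ℝ) (n : ℕ), μ (N.ball 1 (r ^ n * η)) = κ ^ n * μ (N.ball 1 η) := by
    intro η n
    induction n with
    | zero => simp
    | succ n ih =>
      rw [pow_succ', mul_assoc, ← N.image_δ_ball hr.1, hκ _ (N.isOpen_ball 1 _), ih,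
        pow_succ', mul_assoc]
  have hWball : ∀ {η : ℝ}, 0 < η → N.ball 1 η ⊆ W → ∀ n : ℕ, N.ball 1 (r ^ n * η) ⊆ W :=
    fun {η} hη hηW n x hx => hηW <| by
      rw [mem_ball_one] at hx ⊢
      exact hx.trans_le (mul_le_of_le_one_left hη.le (pow_le_one₀ hr.1.le hr.2.le))
  have hfin : ∀ {η : ℝ}, N.ball 1 η ⊆ W → ν (φ '' N.ball 1 η) ≠ ⊤ := by
    intro η hηW htop
    have h := (hcomp _ hηW (N.measurableSet_ball 1 η)).1
    rw [htop, ENNReal.mul_top ha, top_le_iff] at h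
    exact ENNReal.mul_ne_top hct (N.measure_ball_lt_top μ 1 η).ne h
  have hpos : ∀ {η : ℝ}, 0 < η → N.ball 1 η ⊆ W → ν (φ '' N.ball 1 η) ≠ 0 := by
    intro η hη hηW hzero
    have h := (hcomp _ hηW (N.measurableSet_ball 1 η)).2
    rw [hzero, mul_zero, le_zero_iff] at h
    exact mul_ne_zero hc0 (N.measure_ball_pos μ 1 hη).ne' h
  refine le_antisymm ?_ ?_
  · by_contra! hlt
    obtain ⟨m, hm, hmκ⟩ := ENNReal.lt_iff_exists_nnreal_btwn.1 hlt
    rw [← hdet] at hm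
    obtain ⟨δ, hδ, hδ0⟩ := ((addHaar_image_le_mul_of_det_lt ν L hm).and self_mem_nhdsWithin).exists
    obtain ⟨η, hη, hηW, hn⟩ := hstep δ hδ0
    have hind : ∀ n : ℕ, ν (φ '' N.ball 1 (r ^ n * η)) ≤ (m : ℝ≥0∞) ^ n * ν (φ '' N.ball 1 η) := by
      intro n
      induction n with
      | zero => simp
      | succ n ih =>
        rw [(hn n).1, pow_succ', mul_assoc]
        exact (hδ _ _ (hn n).2).trans (mul_le_mul_right ih _)
    refine absurd (ENNReal.le_of_forall_mul_pow_le (x := c * μ (N.ball 1 η))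
      (y := b * ν (φ '' N.ball 1 η)) (mul_ne_zero hc0 (N.measure_ball_pos μ 1 hη).ne')
      (ENNReal.mul_ne_top hb (hfin hηW)) ENNReal.coe_ne_top fun n => ?_) (not_le.2 hmκ)
    have h1 := (hcomp _ (hWball hη hηW n) (N.measurableSet_ball 1 _)).2
    rw [hball] at h1
    calc c * μ (N.ball 1 η) * κ ^ n = c * (κ ^ n * μ (N.ball 1 η)) := by ring
      _ ≤ b * ν (φ '' N.ball 1 (r ^ n * η)) := h1
      _ ≤ b * ((m : ℝ≥0∞) ^ n * ν (φ '' N.ball 1 η)) := mul_le_mul_right (hind n) _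
      _ = b * ν (φ '' N.ball 1 η) * (m : ℝ≥0∞) ^ n := by ring
  · refine ENNReal.le_of_forall_nnreal_lt fun m hm => ?_
    rw [← hdet] at hm
    obtain ⟨δ, hδ, hδ0⟩ := ((mul_le_addHaar_image_of_lt_det ν L hm).and self_mem_nhdsWithin).exists
    obtain ⟨η, hη, hηW, hn⟩ := hstep δ hδ0
    have hind : ∀ n : ℕ, (m : ℝ≥0∞) ^ n * ν (φ '' N.ball 1 η) ≤ ν (φ '' N.ball 1 (r ^ n * η)) := by
      intro n
      induction n with
      | zero => simp
      | succ n ih =>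
        rw [(hn n).1, pow_succ', mul_assoc]
        exact (mul_le_mul_right ih _).trans (hδ _ _ (hn n).2)
    refine ENNReal.le_of_forall_mul_pow_le (x := a * ν (φ '' N.ball 1 η)) (y := c * μ (N.ball 1 η))
      (mul_ne_zero ha (hpos hη hηW)) (ENNReal.mul_ne_top hct (N.measure_ball_lt_top μ 1 η).ne)
      ENNReal.coe_ne_top fun n => ?_
    have h1 := (hcomp _ (hWball hη hηW n) (N.measurableSet_ball 1 _)).1
    rw [hball] at h1
    calc a * ν (φ '' N.ball 1 η) * (m : ℝ≥0∞) ^ n = a * ((m : ℝ≥0∞) ^ n * ν (φ '' N.ball 1 η)) := by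
          ring
      _ ≤ a * ν (φ '' N.ball 1 (r ^ n * η)) := mul_le_mul_right (hind n) _
      _ ≤ c * (κ ^ n * μ (N.ball 1 η)) := h1
      _ = c * μ (N.ball 1 η) * κ ^ n := by ring

/-- The Haar measure of a ball. -/
theorem measure_ball_one [LieGroup 𝓘(ℝ, E) ∞ G] [ConnectedSpace G] [MeasurableSpace G]
    [BorelSpace G] (μ : Measure G) [μ.IsHaarMeasure] {r : ℝ} (hr : 0 < r) :
    μ (N.ball 1 r) = ENNReal.ofReal (r ^ D.homDim) * μ (N.ball 1 1) := by
  rcases lt_trichotomy r 1 with h | h | h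
  · simpa using N.measure_ball_mul_of_lt_one μ ⟨hr, h⟩ 1
  · simp [h]
  · have h1 := N.measure_ball_mul_of_lt_one μ ⟨inv_pos.2 hr, inv_lt_one_of_one_lt₀ h⟩ r
    rw [inv_mul_cancel₀ hr.ne'] at h1
    rw [h1, ← mul_assoc, ← ENNReal.ofReal_mul (by positivity), ← Real.mul_rpow hr.le (by positivity),
      mul_inv_cancel₀ hr.ne', Real.one_rpow, ENNReal.ofReal_one, one_mul]

end HomogeneousNorm

end HaarScaling

/-! ### Cells of a uniform partition, and the inclusion -/

section Partition

variable {E : Type*} [NormedAddCommGroup E] [NormedSpace ℝ E] [FiniteDimensional ℝ E]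
  {G : Type*} [Group G] [TopologicalSpace G] [ChartedSpace E G] [IsTopologicalGroup G]
  [ConnectedSpace G] {D : DilationFamily E G} (N : HomogeneousNorm D)

namespace HomogeneousNorm

theorem norm_inv_mul_le (x y z : G) :
    N.norm (x⁻¹ * y) ≤ N.gamma * (N.norm (x⁻¹ * z) + N.norm (y⁻¹ * z)) := by
  have h := N.norm_mul_le (x⁻¹ * z) (z⁻¹ * y)
  have h1 : x⁻¹ * z * (z⁻¹ * y) = x⁻¹ * y := by group
  have h2 : N.norm (z⁻¹ * y) = N.norm (y⁻¹ * z) := by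
    rw [← N.norm_inv (z⁻¹ * y)]
    congr 1
    group
  rwa [h1, h2] at h

variable [Nontrivial G]

theorem disjoint_ball {x y : G} {s t : ℝ} (h : N.gamma * (s + t) ≤ N.norm (x⁻¹ * y)) :
    Disjoint (N.ball x s) (N.ball y t) := by
  rw [Set.disjoint_left]
  intro z hz hz'
  have hz : N.norm (x⁻¹ * z) < s := hz
  have hz' : N.norm (y⁻¹ * z) < t := hz'
  have h1 := N.norm_inv_mul_le x y z
  have h2 : N.gamma * (N.norm (x⁻¹ * z) + N.norm (y⁻¹ * z)) < N.gamma * (s + t) :=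
    mul_lt_mul_of_pos_left (by linarith) (by linarith [N.one_le_gamma])
  linarith

theorem ball_mul_ball_subset {r : ℝ} :
    N.ball 1 (r / (4 * N.gamma ^ 2)) * N.ball 1 (r / (4 * N.gamma ^ 2)) ⊆
      N.ball 1 (r / (2 * N.gamma)) := by
  rintro _ ⟨a, ha, b, hb, rfl⟩
  rw [mem_ball_one] at ha hb ⊢
  have hγ := N.one_le_gamma
  refine (N.norm_mul_le a b).trans_lt ?_
  calc N.gamma * (N.norm a + N.norm b)
      < N.gamma * (r / (4 * N.gamma ^ 2) + r / (4 * N.gamma ^ 2)) :=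
        mul_lt_mul_of_pos_left (by linarith) (by linarith)
    _ = r / (2 * N.gamma) := by field_simp; ring

end HomogeneousNorm

namespace IsPartitionScale

open HomogeneousNorm

variable {N} [Nontrivial G] [MeasurableSpace G] {π : ℝ → Set (Set G)}

theorem exists_subset_ball (hπ : IsPartitionScale N π) {r : ℝ} (hr : 0 < r) {P : Set G}
    (hP : P ∈ π r) : ∃ x, P ⊆ N.ball x (r / (2 * N.gamma)) := by
  obtain ⟨x, -, -, hx⟩ := ((hπ r hr).2 P hP).2
  refine ⟨x, fun y hy => ?_⟩
  obtain ⟨u, hu, rfl⟩ := hx hy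
  have := N.mem_ball_one.1 (N.ball_mul_ball_subset hu)
  simpa [ball] using this

/-- The radius `r/(4γ²)` absorbs two uses of the quasi-triangle inequality: one for `U²`, one for
two points of a cell. -/
theorem norm_lt (hπ : IsPartitionScale N π) {r : ℝ} (hr : 0 < r) {P : Set G}
    (hP : P ∈ π r) {y z : G} (hy : y ∈ P) (hz : z ∈ P) : N.norm (y⁻¹ * z) < r := by
  obtain ⟨x, hx⟩ := hπ.exists_subset_ball hr hP
  have h1 : N.norm (x⁻¹ * y) < r / (2 * N.gamma) := hx hy
  have h2 : N.norm (x⁻¹ * z) < r / (2 * N.gamma) := hx hz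
  have hγ := N.one_le_gamma
  have h3 : N.norm (y⁻¹ * x) = N.norm (x⁻¹ * y) := by
    rw [← N.norm_inv (y⁻¹ * x)]; congr 1; group
  have h4 : N.norm (z⁻¹ * x) = N.norm (x⁻¹ * z) := by
    rw [← N.norm_inv (z⁻¹ * x)]; congr 1; group
  calc N.norm (y⁻¹ * z) ≤ N.gamma * (N.norm (x⁻¹ * y) + N.norm (x⁻¹ * z)) := by
        rw [← h3, ← h4]; exact N.norm_inv_mul_le y z x
    _ < N.gamma * (r / (2 * N.gamma) + r / (2 * N.gamma)) :=
        mul_lt_mul_of_pos_left (by linarith) (by linarith)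
    _ = r := by field_simp; ring

variable [BorelSpace G] (μ : Measure G) [μ.IsHaarMeasure]

theorem measure_le (hπ : IsPartitionScale N π) {r : ℝ} (hr : 0 < r) {P : Set G}
    (hP : P ∈ π r) : μ P ≤ μ (N.ball 1 r) := by
  obtain ⟨x, hx⟩ := hπ.exists_subset_ball hr hP
  rw [← N.measure_ball μ x]
  refine measure_mono fun y hy => ?_
  have h1 : N.norm (x⁻¹ * y) < r / (2 * N.gamma) := hx hy
  have hγ := N.one_le_gamma
  exact h1.trans_le (div_le_self hr.le (by linarith))

theorem weakSpace_subset (hπ : IsPartitionScale N π) {q p α : ℝ≥0∞} (hq : 1 ≤ q) (hqα : q < α)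
    (hαp : α < p) : weakSpace μ α ⊆ fofanaSpace N μ π q p α := by
  intro f hf
  obtain ⟨C, hC, hb⟩ := exists_rpow_mul_amalgamNorm_le hq hqα hαp f.measurable hf
  refine lt_of_le_of_lt (iSup₂_le fun r hr => ?_) hC.lt_top
  have hV : μ (N.ball 1 r) ≠ ⊤ := (N.measure_ball_lt_top μ 1 r).ne
  have h := hb (π r) (μ (N.ball 1 r)).toNNReal
    (ENNReal.toNNReal_pos (N.measure_ball_pos μ 1 hr).ne' hV) (hπ r hr).1
    (fun P hP => ((hπ r hr).2 P hP).1) (fun P hP => by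
      rw [ENNReal.coe_toNNReal hV]
      exact hπ.measure_le μ hr hP)
  rwa [ENNReal.coe_toNNReal hV] at h

end IsPartitionScale

end Partition

/-! ### Indicators of sets of infinite measure -/

section WeakNorm

theorem weakNorm_indicator_one_eq_top {G : Type*} [MeasurableSpace G] {μ : Measure G} {α : ℝ≥0∞}
    (hα0 : α ≠ 0) (hαt : α ≠ ⊤) {F : Set G} (hF : μ F = ⊤) :
    weakNorm μ α (F.indicator fun _ => (1 : ℂ)) = ⊤ := by
  have ha : 0 < (α⁻¹).toReal :=
    ENNReal.toReal_pos (ENNReal.inv_ne_zero.2 hαt) (ENNReal.inv_ne_top.2 hα0)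
  have hr : ∀ t : ℝ≥0, 1 ≤ rearrangement μ (F.indicator fun _ => (1 : ℂ)) t := by
    intro t
    refine le_iInf₂ fun s hs => ?_
    by_contra! hlt
    have hs1 : s < 1 := by exact_mod_cast hlt
    have hFs : F ⊆ {x | s < ‖F.indicator (fun _ => (1 : ℂ)) x‖₊} := fun x hx => by
      simpa [hx] using hs1
    have h : (⊤ : ℝ≥0∞) ≤ t := by
      rw [← hF]
      exact (measure_mono hFs).trans hs.2
    exact ENNReal.coe_ne_top (top_le_iff.1 h)
  rw [eq_top_iff]
  refine ENNReal.le_of_forall_nnreal_lt fun u _ => ?_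
  -- The rearrangement is at least 1 everywhere, so this `t` gives a value of at least `u + 1`.
  set t : ℝ≥0 := (u + 1) ^ ((α⁻¹).toReal)⁻¹ with ht
  have ht0 : 0 < t := by positivity
  refine le_trans ?_ (le_iSup₂ (f := fun (t : ℝ≥0) (_ : 0 < t) =>
    (t : ℝ≥0∞) ^ (α⁻¹).toReal * rearrangement μ (F.indicator fun _ => (1 : ℂ)) t) t ht0)
  refine le_trans ?_ (mul_le_mul_right (hr t) _)
  rw [mul_one, ← ENNReal.coe_rpow_of_nonneg _ ha.le, ht, ← NNReal.rpow_mul,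
    inv_mul_cancel₀ ha.ne', NNReal.rpow_one]
  exact_mod_cast le_self_add

end WeakNorm

/-! ### Existence of separated centres -/

section Separated

variable {E : Type*} [NormedAddCommGroup E] [NormedSpace ℝ E] [FiniteDimensional ℝ E]
  {G : Type*} [Group G] [TopologicalSpace G] [ChartedSpace E G] [IsTopologicalGroup G]
  [ConnectedSpace G] [Nontrivial G] {D : DilationFamily E G} (N : HomogeneousNorm D)

/-- There are sequences in a homogeneous group whose terms are arbitrarily far apart. -/
theorem HomogeneousNorm.exists_seq_lt_norm (K : ℕ → ℕ → ℝ) :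
    ∃ y : ℕ → G, ∀ i j, i ≠ j → K i j < N.norm ((y i)⁻¹ * y j) := by
  obtain ⟨x₀, hx₀⟩ := exists_ne (1 : G)
  have hx₀' := N.norm_pos hx₀
  have hγ := N.one_le_gamma
  let M : ℕ → ℝ := fun j => ∑ i ∈ Finset.range j, (|K i j| + |K j i|)
  have hM0 : ∀ j, 0 ≤ M j := fun j => Finset.sum_nonneg fun i _ => by positivity
  -- Radii for dilates of one point `x₀ ≠ 1`. The factor `γ` offsets the quasi-triangle constant,
  -- and `M` covers all distances required from earlier terms.
  let R : ℕ → ℝ := fun n => Nat.rec 1 (fun j Rj => N.gamma * (Rj + M (j + 1) + 1)) n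
  have hRs : ∀ j, R (j + 1) = N.gamma * (R j + M (j + 1) + 1) := fun j => rfl
  have hR0 : ∀ j, 0 < R j := by
    intro j
    induction j with
    | zero => exact one_pos
    | succ j ih =>
      rw [hRs]
      have := hM0 (j + 1)
      positivity
  have hmono : Monotone R := monotone_nat_of_le_succ fun j => by
    rw [hRs]
    have := hM0 (j + 1)
    have := hR0 j
    nlinarith
  let y : ℕ → G := fun j => D.δ (R j / N.norm x₀) x₀
  have hy : ∀ j, N.norm (y j) = R j := fun j => by
    rw [N.norm_δ _ (div_pos (hR0 j) hx₀'), div_mul_cancel₀ _ hx₀'.ne']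
  have key : ∀ i j, i < j → |K i j| + |K j i| < N.norm ((y i)⁻¹ * y j) := by
    intro i j hij
    obtain ⟨l, rfl⟩ : ∃ l, j = l + 1 := ⟨j - 1, by omega⟩
    have h1 := N.norm_mul_le (y i) ((y i)⁻¹ * y (l + 1))
    rw [mul_inv_cancel_left, hy (l + 1), hy i, hRs] at h1
    have h2 := le_of_mul_le_mul_left h1 (by linarith)
    have h3 : R i ≤ R l := hmono (by omega)
    have h4 : |K i (l + 1)| + |K (l + 1) i| ≤ M (l + 1) :=
      Finset.single_le_sum (f := fun i => |K i (l + 1)| + |K (l + 1) i|)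
        (fun i _ => by positivity) (Finset.mem_range.2 hij)
    linarith
  refine ⟨y, fun i j hij => ?_⟩
  rcases hij.lt_or_gt with h | h
  · have h1 := key i j h
    have := le_abs_self (K i j)
    have := abs_nonneg (K j i)
    linarith
  · have h1 := key j i h
    have h2 : N.norm ((y i)⁻¹ * y j) = N.norm ((y j)⁻¹ * y i) := by
      rw [← N.norm_inv ((y i)⁻¹ * y j)]; congr 1; group
    have := le_abs_self (K i j)
    have := abs_nonneg (K j i)
    linarith

/-- The required distances depend only on the indices, so pairs `(n, k)` are coded into one
sequence; `K₁ + K₂` handles both conditions. -/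
theorem exists_isSeparatedFamily (q α : ℝ≥0∞) : ∃ x : ℕ → ℕ → G, IsSeparatedFamily N q α x := by
  let K₁ : ℕ → ℝ := fun n => N.gamma * (1 + N.gamma + 2 * N.gamma ^ 2) *
        (2 : ℝ) ^ (((n : ℝ) + 1) * q.toReal / (α.toReal - q.toReal))
  let K₂ : ℕ → ℕ → ℕ → ℕ → ℝ := fun n k m j => 2 * N.gamma ^ 2 *
        |(2 : ℝ) ^ ((2 : ℝ) ^ (D.homDim * (n + 1)) + 1) + (2 : ℝ) ^ ((k : ℤ) - (n : ℤ))
            + (2 : ℝ) ^ (-(n : ℤ) - 1)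
          - (2 : ℝ) ^ ((2 : ℝ) ^ (D.homDim * (m + 1)) + 1) - (2 : ℝ) ^ ((j : ℤ) - (m : ℤ))
            - (2 : ℝ) ^ (-(m : ℤ) - 1)|
  have hγ := N.one_le_gamma
  have hK₁ : ∀ n, 0 ≤ K₁ n := fun n => by positivity
  have hK₂ : ∀ n k m j, 0 ≤ K₂ n k m j := fun n k m j => by positivity
  obtain ⟨y, hy⟩ := N.exists_seq_lt_norm fun i i' =>
    K₁ i.unpair.1 + K₂ i.unpair.1 i.unpair.2 i'.unpair.1 i'.unpair.2
  refine ⟨fun n k => y (Nat.pair n k), ⟨fun n _ k _ j _ hjk => ?_, fun n _ m _ k _ j _ h => ?_⟩⟩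
  · have h := hy (Nat.pair n k) (Nat.pair n j) (fun h => hjk (Nat.pair_eq_pair.1 h).2.symm)
    simp only [Nat.unpair_pair] at h
    exact lt_of_le_of_lt (le_add_of_nonneg_right (hK₂ _ _ _ _)) h
  · have h := hy (Nat.pair n k) (Nat.pair m j) (fun h' => by
      have := Nat.pair_eq_pair.1 h'
      rcases h with h | h
      · exact h this.1.symm
      · exact h this.2.symm)
    simp only [Nat.unpair_pair] at h
    exact lt_of_le_of_lt (le_add_of_nonneg_left (hK₁ _)) h

end Separated

/-! ### The counterexample, level by level -/

section Levels

variable {E : Type*} [NormedAddCommGroup E] [NormedSpace ℝ E] [FiniteDimensional ℝ E]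
  {G : Type*} [Group G] [TopologicalSpace G] [ChartedSpace E G]

theorem two_rpow_le_levelCard (D : DilationFamily E G) (n : ℕ) :
    (2 : ℝ) ^ (D.homDim * (n + 1)) ≤ levelCard D n := by
  rw [levelCard]
  push_cast
  exact (Nat.lt_floor_add_one _).le

theorem levelCard_le (D : DilationFamily E G) (n : ℕ) :
    (levelCard D n : ℝ) ≤ (2 : ℝ) ^ (D.homDim * (n + 1)) + 1 := by
  rw [levelCard]
  push_cast
  gcongr
  exact Nat.floor_le (by positivity)

theorem zpow_neg_sub_one_rpow (n : ℕ) (y : ℝ) :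
    ((2 : ℝ) ^ (-(n : ℤ) - 1)) ^ y = (2 : ℝ) ^ (-(y * (n + 1))) := by
  rw [← Real.rpow_intCast, ← Real.rpow_mul (by norm_num)]
  congr 1
  push_cast
  ring

/-- The lower bound for the distance of the centres of two balls of different levels is at least
`2 * γ ^ 2` as soon as the levels are large enough. -/
theorem exists_forall_one_le_abs_cross (D : DilationFamily E G) (hD : 0 < D.homDim) :
    ∃ n₀ : ℕ, 1 ≤ n₀ ∧ ∀ m n : ℕ, n₀ ≤ m → m < n → ∀ k : ℕ, ∀ j ≤ levelCard D m,
      1 ≤ |(2 : ℝ) ^ ((2 : ℝ) ^ (D.homDim * (n + 1)) + 1) + (2 : ℝ) ^ ((k : ℤ) - (n : ℤ))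
            + (2 : ℝ) ^ (-(n : ℤ) - 1)
          - (2 : ℝ) ^ ((2 : ℝ) ^ (D.homDim * (m + 1)) + 1) - (2 : ℝ) ^ ((j : ℤ) - (m : ℤ))
            - (2 : ℝ) ^ (-(m : ℤ) - 1)| := by
  have h2ρ : 1 < (2 : ℝ) ^ D.homDim := Real.one_lt_rpow one_lt_two hD
  -- For a small homogeneous dimension, `2^{ρ(m+1)}` grows by at least 1 per level only once `m` is
  -- large.
  obtain ⟨n₁, hn₁⟩ := Filter.eventually_atTop.1
    ((tendsto_pow_atTop_atTop_of_one_lt h2ρ).eventually_ge_atTop (1 / ((2 : ℝ) ^ D.homDim - 1)))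
  refine ⟨n₁ + 1, by omega, fun m n hm hmn k j hj => le_trans ?_ (le_abs_self _)⟩
  set a : ℝ := (2 : ℝ) ^ (D.homDim * (m + 1)) with ha
  set b : ℝ := (2 : ℝ) ^ (D.homDim * (n + 1)) with hb
  have ha1 : 1 ≤ a := Real.one_le_rpow one_le_two (by positivity)
  have hab : a + 1 ≤ b := by
    have h1 : a * (2 : ℝ) ^ D.homDim ≤ b := by
      rw [ha, hb, ← Real.rpow_add two_pos]
      refine Real.rpow_le_rpow_of_exponent_le one_le_two ?_
      have : (m : ℝ) + 1 ≤ n := by exact_mod_cast hmn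
      nlinarith
    have h2 : 1 / ((2 : ℝ) ^ D.homDim - 1) ≤ a := by
      refine (hn₁ (m + 1) (by omega)).trans (le_of_eq ?_)
      rw [ha, ← Real.rpow_natCast, ← Real.rpow_mul (by norm_num)]
      push_cast
      rfl
    rw [div_le_iff₀ (by linarith)] at h2
    linarith
  have hA : (4 : ℝ) ≤ (2 : ℝ) ^ (a + 1) := by
    calc (4 : ℝ) = (2 : ℝ) ^ (2 : ℝ) := by norm_num
      _ ≤ (2 : ℝ) ^ (a + 1) := Real.rpow_le_rpow_of_exponent_le one_le_two (by linarith)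
  have hB : 2 * (2 : ℝ) ^ (a + 1) ≤ (2 : ℝ) ^ (b + 1) := by
    calc 2 * (2 : ℝ) ^ (a + 1) = (2 : ℝ) ^ (a + 1 + 1) := by
          rw [Real.rpow_add_one two_ne_zero (a + 1)]; ring
      _ ≤ (2 : ℝ) ^ (b + 1) := Real.rpow_le_rpow_of_exponent_le one_le_two (by linarith)
  -- Uses `j ≤ a + 1` and `m ≥ 1`. The difference is then at least `2^{a+1} - 2^{a+1}/2 - 1 ≥ 1`.
  have hj' : (2 : ℝ) ^ ((j : ℤ) - (m : ℤ)) ≤ (2 : ℝ) ^ (a + 1) / 2 := by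
    calc (2 : ℝ) ^ ((j : ℤ) - (m : ℤ)) = (2 : ℝ) ^ ((j : ℝ) - m) := by
          rw [← Real.rpow_intCast]; push_cast; rfl
      _ ≤ (2 : ℝ) ^ (a + 1 - 1) := by
          refine Real.rpow_le_rpow_of_exponent_le one_le_two ?_
          have h1 : (j : ℝ) ≤ levelCard D m := by exact_mod_cast hj
          have h2 := levelCard_le D m
          have h3 : (1 : ℝ) ≤ m := by exact_mod_cast (by omega : 1 ≤ m)
          linarith
      _ = (2 : ℝ) ^ (a + 1) / 2 := Real.rpow_sub_one two_ne_zero _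
  have hm' : (2 : ℝ) ^ (-(m : ℤ) - 1) ≤ 1 := zpow_le_one_of_nonpos₀ one_le_two (by omega)
  have hk : 0 < (2 : ℝ) ^ ((k : ℤ) - (n : ℤ)) := by positivity
  have hn : 0 < (2 : ℝ) ^ (-(n : ℤ) - 1) := by positivity
  linarith

variable {D : DilationFamily E G} (N : HomogeneousNorm D)

/-- The union of the balls of level `n`. -/
def levelSet (x : ℕ → ℕ → G) (n : ℕ) : Set G :=
  ⋃ j ∈ Finset.Icc 1 (levelCard D n), N.ball (x n j) ((2 : ℝ) ^ (-(n : ℤ) - 1))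

theorem ballUnion_eq (x : ℕ → ℕ → G) : ballUnion N x = ⋃ n : ℕ, levelSet N x (n + 1) := by
  ext y
  simp only [ballUnion, levelSet, mem_iUnion]
  constructor
  · rintro ⟨n, hn, h⟩
    obtain ⟨m, rfl⟩ : ∃ m, n = m + 1 := ⟨n - 1, by omega⟩
    exact ⟨m, h⟩
  · rintro ⟨n, h⟩
    exact ⟨n + 1, by omega, h⟩

variable [LieGroup 𝓘(ℝ, E) ∞ G]

theorem isOpen_levelSet (x : ℕ → ℕ → G) (n : ℕ) : IsOpen (levelSet N x n) := by
  have := topologicalGroup_of_lieGroup (G := G) 𝓘(ℝ, E) ∞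
  exact isOpen_biUnion fun j _ => N.isOpen_ball _ _

theorem isOpen_ballUnion (x : ℕ → ℕ → G) : IsOpen (ballUnion N x) := by
  rw [ballUnion_eq]
  exact isOpen_iUnion fun n => isOpen_levelSet N x _

variable [ConnectedSpace G]

theorem lt_norm_of_mem_ball_level [Nontrivial G] {q α : ℝ≥0∞} (hqα : q < α) (hα : α ≠ ⊤) {x : ℕ → ℕ → G}
    (hx : IsSeparatedFamily N q α x) {n : ℕ} (hn : 1 ≤ n) {r : ℝ}
    (hr : r ≤ (2 : ℝ) ^ (((n : ℝ) + 1) * q.toReal / (α.toReal - q.toReal)))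
    {j k : ℕ} (hj : j ∈ Finset.Icc 1 (levelCard D n)) (hk : k ∈ Finset.Icc 1 (levelCard D n))
    (hjk : j ≠ k) {y z : G} (hy : y ∈ N.ball (x n j) ((2 : ℝ) ^ (-(n : ℤ) - 1)))
    (hz : z ∈ N.ball (x n k) ((2 : ℝ) ^ (-(n : ℤ) - 1))) : r < N.norm (y⁻¹ * z) := by
  have := topologicalGroup_of_lieGroup (G := G) 𝓘(ℝ, E) ∞
  have h := hx.level n hn k hk j hj hjk
  set R : ℝ := (2 : ℝ) ^ (((n : ℝ) + 1) * q.toReal / (α.toReal - q.toReal)) with hR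
  have hlt : q.toReal < α.toReal := (ENNReal.toReal_lt_toReal hqα.ne_top hα).2 hqα
  have hR1 : 1 ≤ R := Real.one_le_rpow one_le_two
    (div_nonneg (mul_nonneg (by positivity) ENNReal.toReal_nonneg) (by linarith))
  have hs : (2 : ℝ) ^ (-(n : ℤ) - 1) ≤ 1 := zpow_le_one_of_nonpos₀ one_le_two (by omega)
  have hγ := N.one_le_gamma
  have hy' : N.norm ((x n j)⁻¹ * y) < (2 : ℝ) ^ (-(n : ℤ) - 1) := hy
  have hz' : N.norm ((x n k)⁻¹ * z) < (2 : ℝ) ^ (-(n : ℤ) - 1) := hz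
  -- Going through `y` and `z`, the centres would be within `γ(1 + 2γ)R`, against the level
  -- separation.
  by_contra! hle
  have h1 := N.norm_inv_mul_le (x n k) (x n j) z
  have h2 : N.norm ((x n j)⁻¹ * z) ≤ N.gamma * (N.norm ((x n j)⁻¹ * y) + N.norm (y⁻¹ * z)) := by
    have := N.norm_mul_le ((x n j)⁻¹ * y) (y⁻¹ * z)
    rwa [mul_assoc, mul_inv_cancel_left] at this
  have h3 : N.gamma * (N.norm ((x n j)⁻¹ * y) + N.norm (y⁻¹ * z)) ≤ N.gamma * (2 * R) :=
    mul_le_mul_of_nonneg_left (by linarith) (by linarith)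
  have h4 : N.gamma * (N.norm ((x n k)⁻¹ * z) + N.norm ((x n j)⁻¹ * z)) ≤
      N.gamma * ((1 + N.gamma + 2 * N.gamma ^ 2) * R) := by
    refine mul_le_mul_of_nonneg_left ?_ (by linarith)
    nlinarith [mul_le_mul_of_nonneg_right hγ (by positivity : 0 ≤ N.gamma * R),
      mul_pos (by linarith : 0 < N.gamma) (by linarith : 0 < R)]
  rw [mul_assoc] at h
  linarith

variable [MeasurableSpace G] [BorelSpace G] (μ : Measure G) [μ.IsHaarMeasure]

theorem measure_ball_level (y : G) (n : ℕ) :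
    μ (N.ball y ((2 : ℝ) ^ (-(n : ℤ) - 1))) =
      ENNReal.ofReal ((2 : ℝ) ^ (-(D.homDim * (n + 1)))) * μ (N.ball 1 1) := by
  have := topologicalGroup_of_lieGroup (G := G) 𝓘(ℝ, E) ∞
  rw [N.measure_ball μ, N.measure_ball_one μ (by positivity), zpow_neg_sub_one_rpow]

variable [Nontrivial G]

theorem measure_levelSet_le (x : ℕ → ℕ → G) (n : ℕ) :
    μ (levelSet N x n) ≤ 2 * μ (N.ball 1 1) := by
  have := topologicalGroup_of_lieGroup (G := G) 𝓘(ℝ, E) ∞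
  refine (measure_biUnion_finset_le _ _).trans ?_
  simp only [measure_ball_level N μ, Finset.sum_const, Nat.card_Icc, add_tsub_cancel_right,
    nsmul_eq_mul]
  rw [← mul_assoc]
  gcongr
  rw [← ENNReal.ofReal_natCast, ← ENNReal.ofReal_mul (by positivity),
    ← ENNReal.ofReal_ofNat 2]
  refine ENNReal.ofReal_le_ofReal ?_
  have h1 := levelCard_le D n
  have h2 : (1 : ℝ) ≤ (2 : ℝ) ^ (D.homDim * (n + 1)) :=
    Real.one_le_rpow one_le_two (mul_nonneg (DilationFamily.homDim_pos D).le (by positivity))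
  rw [Real.rpow_neg (by norm_num), ← div_eq_mul_inv, div_le_iff₀ (by positivity)]
  linarith

/-- A set of small diameter meets at most one ball of each level. -/
theorem measure_inter_levelSet_le {q α : ℝ≥0∞} (hqα : q < α) (hα : α ≠ ⊤) {x : ℕ → ℕ → G}
    (hx : IsSeparatedFamily N q α x) {n : ℕ} (hn : 1 ≤ n) {r : ℝ}
    (hr : r ≤ (2 : ℝ) ^ (((n : ℝ) + 1) * q.toReal / (α.toReal - q.toReal)))
    {P : Set G} (hP : ∀ y ∈ P, ∀ z ∈ P, N.norm (y⁻¹ * z) < r) :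
    μ (P ∩ levelSet N x n) ≤
      ENNReal.ofReal ((2 : ℝ) ^ (-(D.homDim * (n + 1)))) * μ (N.ball 1 1) := by
  rcases (P ∩ levelSet N x n).eq_empty_or_nonempty with he | ⟨y, hyP, hy⟩
  · rw [he, measure_empty]
    exact zero_le
  · simp only [levelSet, mem_iUnion] at hy
    obtain ⟨j, hj, hyj⟩ := hy
    rw [← measure_ball_level N μ (x n j)]
    refine measure_mono ?_
    rintro z ⟨hzP, hz⟩
    simp only [levelSet, mem_iUnion] at hz
    obtain ⟨k, hk, hzk⟩ := hz
    by_cases hjk : j = k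
    · rw [hjk]; exact hzk
    · exact absurd (hP y hyP z hzP)
        (not_lt.2 (lt_norm_of_mem_ball_level N hqα hα hx hn hr hj hk hjk hyj hzk).le)

theorem measure_ball_one_le_measure_levelSet {q α : ℝ≥0∞} (hqα : q < α) (hα : α ≠ ⊤)
    {x : ℕ → ℕ → G} (hx : IsSeparatedFamily N q α x) {n : ℕ} (hn : 1 ≤ n) :
    μ (N.ball 1 1) ≤ μ (levelSet N x n) := by
  have := topologicalGroup_of_lieGroup (G := G) 𝓘(ℝ, E) ∞
  rw [levelSet, measure_biUnion_finset]
  · simp only [measure_ball_level N μ, Finset.sum_const, Nat.card_Icc, add_tsub_cancel_right,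
      nsmul_eq_mul]
    rw [← mul_assoc]
    refine le_mul_of_one_le_left zero_le ?_
    rw [← ENNReal.ofReal_natCast, ← ENNReal.ofReal_mul (by positivity), ← ENNReal.ofReal_one]
    refine ENNReal.ofReal_le_ofReal ?_
    rw [Real.rpow_neg (by norm_num), ← div_eq_mul_inv, le_div_iff₀ (by positivity), one_mul]
    exact two_rpow_le_levelCard D n
  · intro j hj k hk hjk
    refine Set.disjoint_left.2 fun y hy hy' => ?_
    have h := lt_norm_of_mem_ball_level N hqα hα hx hn (r := 0) (by positivity) hj hk hjk hy hy'
    rw [inv_mul_cancel, N.norm_one] at h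
    exact lt_irrefl _ h
  · exact fun j _ => N.measurableSet_ball _ _

/-- Levels from `n₀` on are pairwise disjoint, and each has at least the measure of the unit ball.
-/
theorem measure_ballUnion_eq_top {q α : ℝ≥0∞} (hqα : q < α) (hα : α ≠ ⊤)
    {x : ℕ → ℕ → G} (hx : IsSeparatedFamily N q α x) : μ (ballUnion N x) = ⊤ := by
  have := topologicalGroup_of_lieGroup (G := G) 𝓘(ℝ, E) ∞
  obtain ⟨n₀, hn₀, hcross⟩ := exists_forall_one_le_abs_cross D (DilationFamily.homDim_pos D)
  have hγ := N.one_le_gamma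
  have hdisj : ∀ m n : ℕ, n₀ ≤ m → m < n → Disjoint (levelSet N x m) (levelSet N x n) := by
    intro m n hm hmn
    simp only [levelSet, disjoint_iUnion_left, disjoint_iUnion_right]
    intro j hj k hk
    refine (N.disjoint_ball ?_).symm
    have h := hx.cross n (by omega) m (Finset.mem_Icc.2 ⟨by omega, hmn.le⟩) j hj k hk
      (Or.inl hmn.ne)
    have h1 := hcross m n hm hmn j k (Finset.mem_Icc.1 hk).2
    have hs : (2 : ℝ) ^ (-(n : ℤ) - 1) ≤ 1 := zpow_le_one_of_nonpos₀ one_le_two (by omega)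
    have ht : (2 : ℝ) ^ (-(m : ℤ) - 1) ≤ 1 := zpow_le_one_of_nonpos₀ one_le_two (by omega)
    refine le_trans ?_ h.le
    calc N.gamma * ((2 : ℝ) ^ (-(n : ℤ) - 1) + (2 : ℝ) ^ (-(m : ℤ) - 1))
        ≤ N.gamma * 2 := mul_le_mul_of_nonneg_left (by linarith) (by linarith)
      _ ≤ 2 * N.gamma ^ 2 * 1 := by nlinarith
      _ ≤ _ := mul_le_mul_of_nonneg_left h1 (by positivity)
  have hsub : ⋃ n : ℕ, levelSet N x (n + n₀) ⊆ ballUnion N x := by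
    rw [ballUnion_eq]
    refine iUnion_subset fun n => ?_
    have : n + n₀ = n + n₀ - 1 + 1 := by omega
    rw [this]
    exact subset_iUnion (fun n => levelSet N x (n + 1)) _
  rw [eq_top_iff]
  refine le_trans ?_ (measure_mono hsub)
  rw [measure_iUnion]
  · rw [← ENNReal.tsum_const_eq_top_of_ne_zero (α := ℕ) (N.measure_ball_pos μ 1 one_pos).ne']
    exact ENNReal.tsum_le_tsum fun n =>
      measure_ball_one_le_measure_levelSet N μ hqα hα hx (by omega)
  · intro m n hmn
    rcases hmn.lt_or_gt with h | h
    · exact hdisj _ _ (by omega) (by omega)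
    · exact (hdisj _ _ (by omega) (by omega)).symm
  · exact fun n => (isOpen_levelSet N x _).measurableSet

theorem tsum_two_rpow_neg_mul_rpow_ne_top {κ η : ℝ} (hκ : 0 < κ) (hη : 0 < η) {v : ℝ≥0∞}
    (hv : v ≠ ⊤) :
    ∑' n : ℕ, (ENNReal.ofReal ((2 : ℝ) ^ (-(κ * (n + 1)))) * v) ^ η ≠ ⊤ := by
  have h : ∀ n : ℕ, (ENNReal.ofReal ((2 : ℝ) ^ (-(κ * (n + 1)))) * v) ^ η =
      ENNReal.ofReal (((2 : ℝ) ^ (-(κ * η))) ^ (n + 1)) * v ^ η := fun n => by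
    have he : -(κ * (n + 1)) * η = -(κ * η) * ((n + 1 : ℕ) : ℝ) := by
      push_cast
      ring
    rw [ENNReal.mul_rpow_of_nonneg _ _ hη.le, ENNReal.ofReal_rpow_of_pos (by positivity),
      ← Real.rpow_mul (by norm_num), ← Real.rpow_natCast, ← Real.rpow_mul (by norm_num), he]
  simp only [h]
  rw [ENNReal.tsum_mul_right]
  refine ENNReal.mul_ne_top ?_ (ENNReal.rpow_ne_top_of_nonneg hη.le hv)
  refine Summable.tsum_ofReal_ne_top ((summable_nat_add_iff 1).2
    (summable_geometric_of_lt_one (by positivity) ?_))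
  exact Real.rpow_lt_one_of_one_lt_of_neg one_lt_two (by nlinarith [mul_pos hκ hη])

theorem fofanaNorm_indicator_ballUnion_lt_top {π : ℝ → Set (Set G)} (hπ : IsPartitionScale N π)
    {q p α : ℝ≥0∞} (hq : 1 ≤ q) (hqα : q < α) (hαp : α < p) {x : ℕ → ℕ → G}
    (hx : IsSeparatedFamily N q α x) :
    fofanaNorm N μ π q p α ((ballUnion N x).indicator fun _ => (1 : ℂ)) < ⊤ := by
  have := topologicalGroup_of_lieGroup (G := G) 𝓘(ℝ, E) ∞
  have hq0 : q ≠ 0 := (zero_lt_one.trans_le hq).ne'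
  have hα0 : α ≠ 0 := (zero_lt_one.trans_le (hq.trans hqα.le)).ne'
  have hαt : α ≠ ⊤ := hαp.ne_top
  have hD : 0 < D.homDim := DilationFamily.homDim_pos D
  set a : ℝ := (α⁻¹).toReal with ha
  set b : ℝ := (q⁻¹).toReal with hb
  set e : ℝ := (p⁻¹).toReal with he
  have he0 : 0 ≤ e := ENNReal.toReal_nonneg
  have hea : e < a := (ENNReal.toReal_lt_toReal (ENNReal.inv_ne_top.2 (hα0.bot_lt.trans hαp).ne')
    (ENNReal.inv_ne_top.2 hα0)).2 (ENNReal.inv_lt_inv.2 hαp)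
  have hab : a < b := (ENNReal.toReal_lt_toReal (ENNReal.inv_ne_top.2 hα0)
    (ENNReal.inv_ne_top.2 hq0)).2 (ENNReal.inv_lt_inv.2 hqα)
  set v := μ (N.ball 1 1) with hv
  have hv0 : v ≠ 0 := (N.measure_ball_pos μ 1 one_pos).ne'
  have hvt : v ≠ ⊤ := (N.measure_ball_lt_top μ 1 1).ne
  set s : ℝ := q.toReal / (α.toReal - q.toReal) with hs
  have hs0 : 0 < s := div_pos (ENNReal.toReal_pos hq0 hqα.ne_top)
    (sub_pos.2 ((ENNReal.toReal_lt_toReal hqα.ne_top hαt).2 hqα))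
  -- Majorant independent of `r`: the first summand serves small `r`, the second large `r`. The
  -- index is shifted because levels start at 1.
  let t : ℕ → ℝ≥0∞ := fun n =>
    ((ENNReal.ofReal ((2 : ℝ) ^ (-(D.homDim * ((n + 1 : ℕ) + 1)))) * v) ^ (a - e) +
      (ENNReal.ofReal ((2 : ℝ) ^ (-(s * D.homDim * ((n + 1 : ℕ) + 1)))) * v⁻¹) ^ (b - a) *
        (2 * v) ^ (b - e)) * (2 * v) ^ e
  have hsum : ∀ {κ η : ℝ} {w : ℝ≥0∞}, 0 < κ → 0 < η → w ≠ ⊤ →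
      ∑' n : ℕ, (ENNReal.ofReal ((2 : ℝ) ^ (-(κ * ((n + 1 : ℕ) + 1)))) * w) ^ η ≠ ⊤ := by
    intro κ η w hκ hη hw
    refine ne_top_of_le_ne_top (tsum_two_rpow_neg_mul_rpow_ne_top hκ hη hw) ?_
    exact ENNReal.tsum_comp_le_tsum_of_injective (Nat.succ_injective)
      (fun n : ℕ => (ENNReal.ofReal ((2 : ℝ) ^ (-(κ * (n + 1)))) * w) ^ η)
  have h2v : 2 * v ≠ ⊤ := ENNReal.mul_ne_top (by simp) hvt
  have ht : ∑' n, t n ≠ ⊤ := by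
    simp only [t]
    rw [ENNReal.tsum_mul_right, ENNReal.tsum_add, ENNReal.tsum_mul_right]
    refine ENNReal.mul_ne_top (ENNReal.add_ne_top.2 ⟨hsum hD (by linarith) hvt,
      ENNReal.mul_ne_top (hsum (mul_pos hs0 hD) (by linarith) (ENNReal.inv_ne_top.2 hv0)) ?_⟩) ?_
    · exact ENNReal.rpow_ne_top_of_nonneg (by linarith) h2v
    · exact ENNReal.rpow_ne_top_of_nonneg he0 h2v
  refine lt_of_le_of_lt (iSup₂_le fun r hr => ?_) ht.lt_top
  have hV0 : μ (N.ball 1 r) ≠ 0 := (N.measure_ball_pos μ 1 hr).ne'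
  have hVt : μ (N.ball 1 r) ≠ ⊤ := (N.measure_ball_lt_top μ 1 r).ne
  have hπm : ∀ P ∈ π r, MeasurableSet P := fun P hP => ((hπ r hr).2 P hP).1
  have hle := amalgamNorm_le_tsum (μ := μ) (π := π r) (q := q) (p := p)
    (f := (ballUnion N x).indicator fun _ => (1 : ℂ))
    (g := fun n => (levelSet N x (n + 1)).indicator fun _ => (1 : ℂ)) hq
    ((hq.trans hqα.le).trans hαp.le) hπm
    (fun n => measurable_const.indicator (isOpen_levelSet N x _).measurableSet) (fun y => by
      by_cases hy : y ∈ ballUnion N x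
      · have hy' := hy
        rw [ballUnion_eq] at hy'
        obtain ⟨n, hn⟩ := mem_iUnion.1 hy'
        refine le_trans ?_ (ENNReal.le_tsum n)
        rw [indicator_of_mem hy, indicator_of_mem hn]
      · simp [hy])
  refine (mul_le_mul_right hle _).trans ?_
  rw [← ENNReal.tsum_mul_left]
  refine ENNReal.tsum_le_tsum fun n => ?_
  have hbound : ∀ M : ℝ≥0∞, (∀ P ∈ π r, μ (P ∩ levelSet N x (n + 1)) ≤ M) →
      μ (N.ball 1 r) ^ (a - b) *
        amalgamNorm μ (π r) q p ((levelSet N x (n + 1)).indicator fun _ => (1 : ℂ)) ≤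
      μ (N.ball 1 r) ^ (a - b) * M ^ (b - e) * (2 * v) ^ e := by
    intro M hM
    have h := amalgamNorm_indicator_const_le (μ := μ) (p := p) hq (hqα.trans hαp) (hπ r hr).1 hπm
      (isOpen_levelSet N x (n + 1)).measurableSet 1 hM
    rw [enorm_one, one_mul] at h
    rw [mul_assoc]
    refine mul_le_mul_right (h.trans (mul_le_mul_right ?_ _)) _
    exact ENNReal.rpow_le_rpow (measure_levelSet_le N μ x _) he0
  rcases le_or_gt r ((2 : ℝ) ^ ((((n + 1 : ℕ) : ℝ) + 1) * q.toReal / (α.toReal - q.toReal)))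
    with hrn | hrn
  · set m := ENNReal.ofReal ((2 : ℝ) ^ (-(D.homDim * ((n + 1 : ℕ) + 1)))) * v with hm
    -- With `M = min(V, m)`, the part `M^{b-a} ≤ V^{b-a}` cancels `V^{a-b}` and `M^{a-e} ≤ m^{a-e}`
    -- remains.
    refine (hbound (min (μ (N.ball 1 r)) m) fun P hP => le_min ?_ ?_).trans ?_
    · exact (measure_mono inter_subset_left).trans (hπ.measure_le μ hr hP)
    · exact measure_inter_levelSet_le N μ hqα hαt hx (by omega) hrn
        fun y hy z hz => hπ.norm_lt hr hP hy hz
    · refine mul_le_mul_left (le_trans ?_ le_self_add) _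
      have h1 : b - e = (b - a) + (a - e) := by ring
      rw [h1, ENNReal.rpow_add_of_nonneg _ _ (by linarith) (by linarith), ← mul_assoc]
      have h2 : μ (N.ball 1 r) ^ (a - b) * min (μ (N.ball 1 r)) m ^ (b - a) ≤ 1 := by
        refine (mul_le_mul_right (ENNReal.rpow_le_rpow (min_le_left _ _) (by linarith)) _).trans ?_
        rw [← ENNReal.rpow_add _ _ hV0 hVt]
        simp
      calc _ ≤ 1 * m ^ (a - e) :=
            mul_le_mul' h2 (ENNReal.rpow_le_rpow (min_le_right _ _) (by linarith))
        _ = m ^ (a - e) := one_mul _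
  -- A large cell may meet many balls, so only the total level mass `2v` is used; the decay comes
  -- from `V^{a-b}`.
  · refine (hbound (2 * v) fun P _ =>
      (measure_mono inter_subset_right).trans (measure_levelSet_le N μ x _)).trans ?_
    refine mul_le_mul_left (le_trans (mul_le_mul_left ?_ _) le_add_self) _
    have h1 : a - b = -(b - a) := by ring
    rw [h1, ENNReal.rpow_neg, ← ENNReal.inv_rpow]
    refine ENNReal.rpow_le_rpow ?_ (by linarith)
    rw [N.measure_ball_one μ hr, ENNReal.mul_inv (Or.inr hvt) (Or.inr hv0),
      ← ENNReal.ofReal_inv_of_pos (by positivity)]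
    refine mul_le_mul_left (ENNReal.ofReal_le_ofReal ?_) _
    rw [Real.rpow_neg (by norm_num)]
    refine inv_anti₀ (by positivity) ?_
    calc (2 : ℝ) ^ (s * D.homDim * ((n + 1 : ℕ) + 1))
        = ((2 : ℝ) ^ ((((n + 1 : ℕ) : ℝ) + 1) * q.toReal / (α.toReal - q.toReal))) ^ D.homDim := by
          rw [← Real.rpow_mul (by norm_num)]
          congr 1
          rw [hs]
          ring
      _ ≤ r ^ D.homDim := Real.rpow_le_rpow (by positivity) hrn.le hD.le

end Levels

theorem mainTheorem5
    {E : Type*} [NormedAddCommGroup E] [NormedSpace ℝ E] [FiniteDimensional ℝ E]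
    {G : Type*} [Group G] [TopologicalSpace G] [ChartedSpace E G] [LieGroup 𝓘(ℝ, E) ∞ G]
    [SimplyConnectedSpace G] [Group.IsNilpotent G] [Nontrivial G]
    [MeasurableSpace G] [BorelSpace G] (μ : Measure G) [μ.IsHaarMeasure]
    (D : DilationFamily E G) (N : HomogeneousNorm D)
    (π : ℝ → Set (Set G)) (hπ : IsPartitionScale N π)
    (q p α : ℝ≥0∞) (hq : 1 ≤ q) (hqα : q < α) (hαp : α < p) :
    (∀ x : ℕ → ℕ → G, IsSeparatedFamily N q α x →
      ∃ hf : AEStronglyMeasurable ((ballUnion N x).indicator (fun _ => (1 : ℂ))) μ,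
        AEEqFun.mk _ hf ∈ fofanaSpace N μ π q p α ∧
        AEEqFun.mk _ hf ∉ weakSpace μ α) ∧
    weakSpace μ α ⊂ fofanaSpace N μ π q p α := by
  have := topologicalGroup_of_lieGroup (G := G) 𝓘(ℝ, E) ∞
  have hα0 : α ≠ 0 := (zero_lt_one.trans_le (hq.trans hqα.le)).ne'
  have hαt : α ≠ ⊤ := hαp.ne_top
  have key : ∀ x : ℕ → ℕ → G, IsSeparatedFamily N q α x →
      ∃ hf : AEStronglyMeasurable ((ballUnion N x).indicator (fun _ => (1 : ℂ))) μ,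
        AEEqFun.mk _ hf ∈ fofanaSpace N μ π q p α ∧
        AEEqFun.mk _ hf ∉ weakSpace μ α := by
    intro x hx
    have hf : AEStronglyMeasurable ((ballUnion N x).indicator (fun _ => (1 : ℂ))) μ :=
      aestronglyMeasurable_const.indicator (isOpen_ballUnion N x).measurableSet
    have hae := AEEqFun.coeFn_mk _ hf
    refine ⟨hf, ?_, ?_⟩
    · change fofanaNorm N μ π q p α _ < ⊤
      have h := fofanaNorm_indicator_ballUnion_lt_top N μ hπ hq hqα hαp hx
      simpa only [fofanaNorm, amalgamNorm_congr_ae hae] using h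
    · change ¬ weakNorm μ α _ < ⊤
      rw [weakNorm_congr_ae hae,
        weakNorm_indicator_one_eq_top hα0 hαt (measure_ballUnion_eq_top N μ hqα hαt hx)]
      exact lt_irrefl _
  refine ⟨key, hπ.weakSpace_subset μ hq hqα hαp, fun hsub => ?_⟩
  obtain ⟨x, hx⟩ := exists_isSeparatedFamily N q α
  obtain ⟨hf, h1, h2⟩ := key x hx
  exact h2 (hsub h1)
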